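/- Let $K$ be a field, let $n\ge 3$, and let $M=\langle a_1,\dots,a_n\rangle$ be the Chinese monoid of rank $n$, defined by the relations $a_ja_ia_k=a_ja_ka_i=a_ka_ja_i$ for $i\le k\le j$. Let $B=\langle p,q : qp=1\rangle$ be the bicyclic monoid. For a congruence $\eta$ on $M$ let $I_\eta$ be the ideal of $K[M]$ spanned over $K$ by all $s-t$ with $(s,t)\in\eta$. The finite tree $D$. Its vertices are diagrams on the generators $a_1,\dots,a_n$, built from dots (single used generators) and arcs (pairs of used generators), each generator being used at most once. The root is the diagram without used generators. The first level consists of the dots $a_s$, $2\le s\le n-1$, and the arcs $a_sa_{s-1}$, $2\le s\le n$. Let $d$ be a diagram other than the root; its used generators form a segment $a_u,\dots,a_v$. If $d$ contains an arc using $a_1$ or $a_n$, then $d$ is a leaf and nothing is added to it. Otherwise the descendants of $d$ on the next level are: (i) the diagram obtained by adding the arc $a_{v+1}a_{u-1}$; (ii) if the last step in the construction of $d$ was an arc, the diagrams obtained by adding the dot $a_{u-1}$ (if $u-1\ge 2$) or the dot $a_{v+1}$ (if $v+1\le n-1$); (iii) if the last step was a dot added on the left (on the right) in a level after the first, the diagram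 obtained by adding the dot $a_{u-1}$, if $u-1\ge2$ (respectively the dot $a_{v+1}$, if $v+1\le n-1$). After a dot of the first level only (i) is allowed. The congruences $\rho(d)$. For the root, $\rho(d)$ is trivial. For the dot $a_s$ in the first level, $\rho(d)$ is the congruence generated by the pairs $(a_ma_i,a_ia_m)$ for $m,i\ge s$ and for $m,i\le s$. For the arc $a_sa_{s-1}$ in the first level, $\rho(d)$ is the congruence generated by the pairs $(a_ma_i,a_ia_m)$ and $(a_ia_{s-1}a_m,a_ma_{s-1}a_i)$ for $m,i\ge s$, and $(a_la_m,a_ma_l)$ and $(a_la_sa_m,a_ma_sa_l)$ for $l,m\le s-1$. To each dot $a_s$ one associates the homomorphism $M\to\mathbb N$ (with $\mathbb N=\langle g\rangle$ written multiplicatively) given by $a_s\mapsto g$ and $a_l\mapsto 1$ for $l\ne s$. To each arc $a_ya_x$, $x<y$, one associates the homomorphism $M\to B\times\mathbb Z$ (with $\mathbb Z=\langle g,g^{-1}\rangle$) given by $a_x\mapsto(p,g)$, $a_y\mapsto(q,1)$, $a_l\mapsto(p,1)$ for $l<x$, $a_l\mapsto(q,1)$ for $l>y$, and $a_l\mapsto(1,1)$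 for $x<l<y$. If $d'$ is obtained from a diagram $d$ other than the root by adding a dot or an arc, let $S_{d'}$ be the product of the monoids $\mathbb N$ and $B\times\mathbb Z$ associated with the dots and arcs of $d'$. Then $\rho(d')$ is the kernel of the homomorphism $M\to M/\rho(d)\times S_{d'}$ whose first component sends every generator used in $d'$ to $1$ and every other generator to its class, and whose components in $S_{d'}$ are the homomorphisms associated with the dots and arcs of $d'$. Then, for every leaf $d$ of $D$, the ideal $I_{\rho(d)}$ of $K[M]$ is prime: it is proper, and $x\,K[M]\,y\subseteq I_{\rho(d)}$ implies $x\in I_{\rho(d)}$ or $y\in I_{\rho(d)}$, for all $x,y\in K[M]$. -/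

import Mathlib

namespace ChineseAlgebra

/-! ### The Chinese monoid and its monoid algebra -/

/-- The indices `1, …, n` of the generators. -/
abbrev Idx (n : ℕ) : Type := {i : ℕ // 1 ≤ i ∧ i ≤ n}

/-- The defining relations `a_j a_i a_k = a_j a_k a_i = a_k a_j a_i` for `i ≤ k ≤ j`. -/
inductive ChineseRel (n : ℕ) : FreeMonoid (Idx n) → FreeMonoid (Idx n) → Prop
  | first (i k j : Idx n) (hik : i ≤ k) (hkj : k ≤ j) :
      ChineseRel n (FreeMonoid.of j * FreeMonoid.of i * FreeMonoid.of k)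
        (FreeMonoid.of j * FreeMonoid.of k * FreeMonoid.of i)
  | second (i k j : Idx n) (hik : i ≤ k) (hkj : k ≤ j) :
      ChineseRel n (FreeMonoid.of j * FreeMonoid.of k * FreeMonoid.of i)
        (FreeMonoid.of k * FreeMonoid.of j * FreeMonoid.of i)

/-- The Chinese monoid `M` of rank `n`. -/
abbrev ChineseMonoid (n : ℕ) : Type := PresentedMonoid (ChineseRel n)

/-- The generator `a_i` of the Chinese monoid. -/
def gen {n : ℕ} (i : Idx n) : ChineseMonoid n := PresentedMonoid.of (ChineseRel n) i

/-- The homomorphism out of the Chinese monoid with prescribed values on the generators. -/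
def liftHom {n : ℕ} {T : Type} [Monoid T] (f : Idx n → T)
    (h : ∀ i k j : Idx n, i ≤ k → k ≤ j →
      f j * f i * f k = f j * f k * f i ∧ f j * f k * f i = f k * f j * f i) :
    ChineseMonoid n →* T :=
  PresentedMonoid.lift f (by
    intro a b hab
    cases hab with
    | first i k j hik hkj => simpa using (h i k j hik hkj).1
    | second i k j hik hkj => simpa using (h i k j hik hkj).2)

theorem liftHom_gen {n : ℕ} {T : Type} [Monoid T] (f : Idx n → T)
    (h : ∀ i k j : Idx n, i ≤ k → k ≤ j →
      f j * f i * f k = f j * f k * f i ∧ f j * f k * f i = f k * f j * f i) (i : Idx n) :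
    liftHom f h (gen i) = f i := rfl

/-! ### Ideals of a monoid algebra given by congruences; prime ideals -/

/-- The `K`-linear span of all `s - t` with `(s, t) ∈ η`. -/
noncomputable def congSpan (K : Type*) [Field K] {S : Type*} [Monoid S] (η : Con S) :
    Submodule K (MonoidAlgebra K S) :=
  Submodule.span K {x | ∃ s t : S, η s t ∧ x = MonoidAlgebra.of K S s - MonoidAlgebra.of K S t}

theorem mul_mem_congSpan (K : Type*) [Field K] {S : Type*} [Monoid S] (η : Con S)
    (x y : MonoidAlgebra K S) (hy : y ∈ congSpan K η) : x * y ∈ congSpan K η := by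
  induction x using MonoidAlgebra.induction_on with
  | of m =>
    refine Submodule.span_induction (p := fun y _ => MonoidAlgebra.of K S m * y ∈ congSpan K η)
      ?_ ?_ ?_ ?_ hy
    · rintro _ ⟨s, t, hst, rfl⟩
      refine Submodule.subset_span ⟨m * s, m * t, η.mul (η.refl m) hst, ?_⟩
      rw [mul_sub, map_mul, map_mul]
    · rw [mul_zero]; exact Submodule.zero_mem _
    · intro a b _ _ ha hb
      rw [mul_add]; exact Submodule.add_mem _ ha hb
    · intro c a _ ha
      rw [mul_smul_comm]; exact Submodule.smul_mem _ c ha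
  | add f g hf hg => rw [add_mul]; exact Submodule.add_mem _ hf hg
  | smul c f hf => rw [smul_mul_assoc]; exact Submodule.smul_mem _ c hf

theorem congSpan_mul_mem (K : Type*) [Field K] {S : Type*} [Monoid S] (η : Con S)
    (x y : MonoidAlgebra K S) (hx : x ∈ congSpan K η) : x * y ∈ congSpan K η := by
  induction y using MonoidAlgebra.induction_on with
  | of m =>
    refine Submodule.span_induction (p := fun x _ => x * MonoidAlgebra.of K S m ∈ congSpan K η)
      ?_ ?_ ?_ ?_ hx
    · rintro _ ⟨s, t, hst, rfl⟩
      refine Submodule.subset_span ⟨s * m, t * m, η.mul hst (η.refl m), ?_⟩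
      rw [sub_mul, map_mul, map_mul]
    · rw [zero_mul]; exact Submodule.zero_mem _
    · intro a b _ _ ha hb
      rw [add_mul]; exact Submodule.add_mem _ ha hb
    · intro c a _ ha
      rw [smul_mul_assoc]; exact Submodule.smul_mem _ c ha
  | add f g hf hg => rw [mul_add]; exact Submodule.add_mem _ hf hg
  | smul c f hf => rw [mul_smul_comm]; exact Submodule.smul_mem _ c hf

/-- The ideal `I_η` of `K[S]`: the span of all `s - t` with `(s, t) ∈ η`, as a two-sided ideal. -/
noncomputable def congIdeal (K : Type*) [Field K] {S : Type*} [Monoid S] (η : Con S) :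
    TwoSidedIdeal (MonoidAlgebra K S) :=
  TwoSidedIdeal.mk' (congSpan K η : Set (MonoidAlgebra K S))
    (Submodule.zero_mem _)
    (fun hx hy => Submodule.add_mem _ hx hy)
    (fun hx => Submodule.neg_mem _ hx)
    (fun {x y} hy => mul_mem_congSpan K η x y hy)
    (fun {x y} hx => congSpan_mul_mem K η x y hx)

/-- Prime ideals of a (not necessarily commutative) ring `R`: proper two-sided ideals `P` such that
`x R y ⊆ P` implies `x ∈ P` or `y ∈ P`. -/
def IsPrimeIdeal {R : Type*} [Ring R] (P : TwoSidedIdeal R) : Prop :=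
  P ≠ ⊤ ∧ ∀ x y : R, (∀ r : R, x * r * y ∈ P) → x ∈ P ∨ y ∈ P

/-! ### Congruences of `♡` and `♢` type -/

/-- The generating pairs of the congruence of `♡` type with distinguished generator `a_s`. -/
inductive HeartRel (n s : ℕ) : ChineseMonoid n → ChineseMonoid n → Prop
  | right (m i : Idx n) (hm : s ≤ m.1) (hi : s ≤ i.1) :
      HeartRel n s (gen m * gen i) (gen i * gen m)
  | left (l m : Idx n) (hl : l.1 ≤ s) (hm : m.1 ≤ s) :
      HeartRel n s (gen l * gen m) (gen m * gen l)

/-- The generating pairs of the congruence of `♢` type with distinguished generators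
`a_{s-1}`, `a_s`. -/
inductive DiamondRel (n s : ℕ) : ChineseMonoid n → ChineseMonoid n → Prop
  | right (m i : Idx n) (hm : s ≤ m.1) (hi : s ≤ i.1) :
      DiamondRel n s (gen m * gen i) (gen i * gen m)
  | rightTriple (m i c : Idx n) (hm : s ≤ m.1) (hi : s ≤ i.1) (hc : c.1 + 1 = s) :
      DiamondRel n s (gen i * gen c * gen m) (gen m * gen c * gen i)
  | left (l m : Idx n) (hl : l.1 + 1 ≤ s) (hm : m.1 + 1 ≤ s) :
      DiamondRel n s (gen l * gen m) (gen m * gen l)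
  | leftTriple (l m c : Idx n) (hl : l.1 + 1 ≤ s) (hm : m.1 + 1 ≤ s) (hc : c.1 = s) :
      DiamondRel n s (gen l * gen c * gen m) (gen m * gen c * gen l)

/-! ### The tree `D` -/

/-- The kind of the last step in the construction of a diagram: a dot in the first level, an arc
(in any level), or a dot added in a later level on the left or on the right. -/
inductive Step
  | firstDot
  | arc
  | dotLeft
  | dotRight

/-- The vertices of `D` other than the root. `Diagram n t u v` is the type of the diagrams whose
used generators are `a_u, …, a_v` and whose last construction step is of kind `t`. The order of the
construction steps is determined by the picture, so a diagram is the same thing as the list of its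
construction steps. -/
inductive Diagram (n : ℕ) : Step → ℕ → ℕ → Type
  /-- first level: the dot `a_s`, for `s = 2, …, n - 1` -/
  | dot (s : ℕ) (hs : 2 ≤ s) (hsn : s < n) : Diagram n .firstDot s s
  /-- first level: the arc `a_{x+1} a_x`, that is `a_s a_{s-1}` with `s = x + 1 = 2, …, n` -/
  | arc (x : ℕ) (hx : 1 ≤ x) (hxn : x < n) : Diagram n .arc x (x + 1)
  /-- an arc joining the two neighbours `a_u`, `a_{v+1}` of the used segment `a_{u+1}, …, a_v` -/
  | arcAbove {t : Step} {u v : ℕ} (d : Diagram n t (u + 1) v) (hu : 1 ≤ u) (hv : v < n) :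
      Diagram n .arc u (v + 1)
  /-- a dot `a_u` next to the used segment `a_{u+1}, …, a_v` of a diagram without extreme arc; it
  follows an arc or a dot on the same side, and `a_1` is never used as a dot -/
  | dotLeft {t : Step} {u v : ℕ} (d : Diagram n t (u + 1) v) (ht : t = .arc ∨ t = .dotLeft)
      (hu : 2 ≤ u) (hv : v < n) : Diagram n .dotLeft u v
  /-- a dot `a_{v+1}` next to the used segment `a_u, …, a_v` of a diagram without extreme arc; it
  follows an arc or a dot on the same side, and `a_n` is never used as a dot -/
  | dotRight {t : Step} {u v : ℕ} (d : Diagram n t u v) (ht : t = .arc ∨ t = .dotRight)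
      (hu : 2 ≤ u) (hv : v + 1 < n) : Diagram n .dotRight u (v + 1)

/-- The vertices of the tree `D`. -/
inductive Vertex (n : ℕ) : Type
  | root : Vertex n
  | node {t : Step} {u v : ℕ} (d : Diagram n t u v) : Vertex n

/-- A leaf of `D` is a vertex in which an extreme arc, that is an arc using `a_1` or `a_n`, has
appeared. Nothing is added to such a vertex, so this arc is the last step. -/
def Vertex.IsLeaf {n : ℕ} : Vertex n → Prop
  | .root => False
  | .node (t := t) (u := u) (v := v) _ => t = Step.arc ∧ (u = 1 ∨ v = n)

/-! ### The monoids `S_t` -/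

/-- The relation `q p = 1`; here `p` is `true` and `q` is `false`. -/
inductive BicyclicRel : FreeMonoid Bool → FreeMonoid Bool → Prop
  | qp : BicyclicRel (FreeMonoid.of false * FreeMonoid.of true) 1

/-- The bicyclic monoid `B = ⟨p, q : q p = 1⟩`. -/
abbrev Bicyclic : Type := PresentedMonoid BicyclicRel

/-- The generator `p` of the bicyclic monoid. -/
def Bicyclic.p : Bicyclic := PresentedMonoid.of BicyclicRel true

/-- The generator `q` of the bicyclic monoid. -/
def Bicyclic.q : Bicyclic := PresentedMonoid.of BicyclicRel false

theorem Bicyclic.q_mul_p : Bicyclic.q * Bicyclic.p = 1 :=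
  PresentedMonoid.mk_eq_mk_of_rel BicyclicRel.qp

/-- The product `S_t` of copies of `ℕ` (one for each dot) and `B × ℤ` (one for each arc). -/
def SType {n : ℕ} : {t : Step} → {u v : ℕ} → Diagram n t u v → Type
  | _, _, _, .dot _ _ _ => Multiplicative ℕ
  | _, _, _, .arc _ _ _ => Bicyclic × Multiplicative ℤ
  | _, _, _, .arcAbove d _ _ => SType d × (Bicyclic × Multiplicative ℤ)
  | _, _, _, .dotLeft d _ _ _ => SType d × Multiplicative ℕ
  | _, _, _, .dotRight d _ _ _ => SType d × Multiplicative ℕ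

instance instMonoidSType {n : ℕ} :
    {t : Step} → {u v : ℕ} → (d : Diagram n t u v) → Monoid (SType d)
  | _, _, _, .dot _ _ _ => inferInstanceAs (Monoid (Multiplicative ℕ))
  | _, _, _, .arc _ _ _ => inferInstanceAs (Monoid (Bicyclic × Multiplicative ℤ))
  | _, _, _, .arcAbove d _ _ =>
    letI := instMonoidSType d
    inferInstanceAs (Monoid (SType d × (Bicyclic × Multiplicative ℤ)))
  | _, _, _, .dotLeft d _ _ _ =>
    letI := instMonoidSType d
    inferInstanceAs (Monoid (SType d × Multiplicative ℕ))
  | _, _, _, .dotRight d _ _ _ =>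
    letI := instMonoidSType d
    inferInstanceAs (Monoid (SType d × Multiplicative ℕ))

/-- The `ℕ`-component belonging to a dot `a_s`: `a_s ↦ g`, and `a_l ↦ 1` for `l ≠ s`. -/
def dotHom (n s : ℕ) : ChineseMonoid n →* Multiplicative ℕ :=
  liftHom (fun l => if l.1 = s then Multiplicative.ofAdd 1 else 1)
    (fun _ _ _ _ _ => ⟨by ac_rfl, by ac_rfl⟩)

/-- The image of `a_l` in the `B`-component belonging to an arc joining `a_x` and `a_y`, `x < y`. -/
def arcVal (x y l : ℕ) : Bicyclic :=
  if l ≤ x then Bicyclic.p else if y ≤ l then Bicyclic.q else 1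

theorem arcVal_rel (x y i k j : ℕ) (hik : i ≤ k) (hkj : k ≤ j) :
    arcVal x y j * arcVal x y i * arcVal x y k = arcVal x y j * arcVal x y k * arcVal x y i ∧
    arcVal x y j * arcVal x y k * arcVal x y i = arcVal x y k * arcVal x y j * arcVal x y i := by
  have h := Bicyclic.q_mul_p
  unfold arcVal
  split_ifs <;> first | omega | simp [h, mul_assoc]

/-- The `B × ℤ`-component belonging to an arc joining `a_x` and `a_y`, `x < y`: `a_x ↦ (p, g)`,
`a_y ↦ (q, 1)`, `a_l ↦ (p, 1)` for `l < x`, `a_l ↦ (q, 1)` for `l > y`, and `a_l ↦ (1, 1)` for the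
generators under the arc. -/
def arcHom (n x y : ℕ) : ChineseMonoid n →* Bicyclic × Multiplicative ℤ :=
  MonoidHom.prod
    (liftHom (fun l => arcVal x y l.1) (fun i k j hik hkj => arcVal_rel x y i k j hik hkj))
    (liftHom (fun l => if l.1 = x then Multiplicative.ofAdd 1 else 1)
      (fun _ _ _ _ _ => ⟨by ac_rfl, by ac_rfl⟩))

/-- The component in `S_t` of the homomorphism from `M` associated with the branch of `D` leading
to the diagram. -/
def sHom {n : ℕ} : {t : Step} → {u v : ℕ} → (d : Diagram n t u v) → (ChineseMonoid n →* SType d)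
  | _, _, _, .dot s _ _ => dotHom n s
  | _, _, _, .arc x _ _ => arcHom n x (x + 1)
  | _, u, _, .arcAbove (v := v) d _ _ => MonoidHom.prod (sHom d) (arcHom n u (v + 1))
  | _, u, _, .dotLeft d _ _ _ => MonoidHom.prod (sHom d) (dotHom n u)
  | _, _, _, .dotRight (v := v) d _ _ _ => MonoidHom.prod (sHom d) (dotHom n (v + 1))

/-! ### The congruences `ρ(d)` -/

/-- The unused generators on each of the two sides of `a_u, …, a_v` commute modulo `ρ`. -/
def CommuteOutside {n : ℕ} (u v : ℕ) (ρ : Con (ChineseMonoid n)) : Prop :=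
  ∀ i j : Idx n, (i.1 < u ∧ j.1 < u) ∨ (v < i.1 ∧ v < j.1) →
    ρ (gen i * gen j) (gen j * gen i)

theorem dotHom_gen_eq {n s : ℕ} (i j : Idx n) (hi : i.1 ≠ s) (hj : j.1 ≠ s) :
    dotHom n s (gen i) = dotHom n s (gen j) := by
  simp [dotHom, liftHom_gen, hi, hj]

theorem arcHom_gen_eq {n x y : ℕ} (hxy : x < y) (i j : Idx n)
    (h : (i.1 < x ∧ j.1 < x) ∨ (y < i.1 ∧ y < j.1)) :
    arcHom n x y (gen i) = arcHom n x y (gen j) := by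
  have hi : i.1 ≠ x := by omega
  have hj : j.1 ≠ x := by omega
  rcases h with h | h
  · have h1 : i.1 ≤ x := by omega
    have h2 : j.1 ≤ x := by omega
    simp [arcHom, liftHom_gen, arcVal, hi, hj, h1, h2]
  · have h1 : ¬ i.1 ≤ x := by omega
    have h2 : ¬ j.1 ≤ x := by omega
    have h3 : y ≤ i.1 := by omega
    have h4 : y ≤ j.1 := by omega
    simp [arcHom, liftHom_gen, arcVal, hi, hj, h1, h2, h3, h4]

theorem Diagram.le {n : ℕ} {t : Step} {u v : ℕ} (d : Diagram n t u v) : u ≤ v := by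
  induction d <;> omega

theorem sHom_gen_eq {n : ℕ} {t : Step} {u v : ℕ} (d : Diagram n t u v) (i j : Idx n)
    (h : (i.1 < u ∧ j.1 < u) ∨ (v < i.1 ∧ v < j.1)) : sHom d (gen i) = sHom d (gen j) := by
  induction d with
  | dot s hs hsn => exact dotHom_gen_eq i j (by omega) (by omega)
  | arc x hx hxn => exact arcHom_gen_eq (by omega) i j h
  | arcAbove d hu hv ih =>
    have := d.le
    exact Prod.ext (ih (by omega)) (arcHom_gen_eq (by omega) i j h)
  | dotLeft d ht hu hv ih =>
    have := d.le
    exact Prod.ext (ih (by omega)) (dotHom_gen_eq i j (by omega) (by omega))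
  | dotRight d ht hu hv ih =>
    have := d.le
    exact Prod.ext (ih (by omega)) (dotHom_gen_eq i j (by omega) (by omega))

/-- The homomorphism `M → M/ρ` which sends the generators `a_u, …, a_v` to `1` and every other
generator to its class. -/
def quotHom {n : ℕ} (u v : ℕ) (ρ : Con (ChineseMonoid n)) (hρ : CommuteOutside u v ρ) :
    ChineseMonoid n →* ρ.Quotient :=
  liftHom (fun l => if u ≤ l.1 ∧ l.1 ≤ v then 1 else (gen l : ρ.Quotient)) (by
    have hcomm : ∀ i j : Idx n, (i.1 < u ∧ j.1 < u) ∨ (v < i.1 ∧ v < j.1) →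
        (gen i : ρ.Quotient) * gen j = gen j * gen i := fun i j h => by
      rw [← Con.coe_mul, ← Con.coe_mul]
      exact (Con.eq ρ).2 (hρ i j h)
    have hrel : ∀ i k j : Idx n, i ≤ k → k ≤ j →
        (gen j : ρ.Quotient) * gen i * gen k = gen j * gen k * gen i ∧
        (gen j : ρ.Quotient) * gen k * gen i = gen k * gen j * gen i := fun i k j hik hkj => by
      simp only [← Con.coe_mul]
      exact ⟨congrArg _ (PresentedMonoid.mk_eq_mk_of_rel (ChineseRel.first i k j hik hkj)),
        congrArg _ (PresentedMonoid.mk_eq_mk_of_rel (ChineseRel.second i k j hik hkj))⟩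
    intro i k j hik hkj
    have hik' : i.1 ≤ k.1 := hik
    have hkj' : k.1 ≤ j.1 := hkj
    split_ifs with hj hi hk hk hi hk hk <;> try simp only [one_mul, mul_one, and_self, and_true]
    · exact hcomm i k (by omega)
    · exact ⟨trivial, hcomm j k (by omega)⟩
    · exact hrel i k j hik hkj)

theorem quotHom_gen {n u v : ℕ} {ρ : Con (ChineseMonoid n)} (hρ : CommuteOutside u v ρ)
    (l : Idx n) (hl : ¬ (u ≤ l.1 ∧ l.1 ≤ v)) : quotHom u v ρ hρ (gen l) = (gen l : ρ.Quotient) :=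
  if_neg hl

theorem commuteOutside_mono {n u v u' v' : ℕ} {ρ : Con (ChineseMonoid n)} (hu : u' ≤ u)
    (hv : v ≤ v') (h : CommuteOutside u v ρ) : CommuteOutside u' v' ρ :=
  fun i j hij => h i j (by omega)

theorem commuteOutside_ker {n : ℕ} {t : Step} {u v : ℕ} (d : Diagram n t u v)
    (ρ : Con (ChineseMonoid n)) (hρ : CommuteOutside u v ρ) :
    CommuteOutside u v (Con.ker ((quotHom u v ρ hρ).prod (sHom d))) := by
  intro i j hij
  rw [Con.ker_rel]
  refine Prod.ext ?_ ?_
  · change quotHom u v ρ hρ (gen i * gen j) = quotHom u v ρ hρ (gen j * gen i)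
    have h1 : ¬ (u ≤ i.1 ∧ i.1 ≤ v) := by have := d.le; omega
    have h2 : ¬ (u ≤ j.1 ∧ j.1 ≤ v) := by have := d.le; omega
    rw [map_mul, map_mul, quotHom_gen hρ i h1, quotHom_gen hρ j h2]
    rw [← Con.coe_mul, ← Con.coe_mul]
    exact (Con.eq ρ).2 (hρ i j hij)
  · change sHom d (gen i * gen j) = sHom d (gen j * gen i)
    rw [map_mul, map_mul, sHom_gen_eq d i j hij]

/-- The congruence of a diagram, with the property that makes the next step well defined. In the
first level it is the congruence of `♡` or `♢` type. If `d'` is obtained from `d` by adding a dot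
or an arc, then `ρ(d')` is the kernel of the homomorphism from `M` to `M/ρ(d) × S`, with `S`
belonging to `d'`, whose first component sends the generators used in `d'` to `1` and every other
one to its class, and whose second component is `sHom d'`. -/
def rhoAux {n : ℕ} : {t : Step} → {u v : ℕ} → Diagram n t u v →
    {ρ : Con (ChineseMonoid n) // CommuteOutside u v ρ}
  | _, _, _, .dot s _ _ => ⟨conGen (HeartRel n s), by
      rintro i j (⟨hi, hj⟩ | ⟨hi, hj⟩)
      · exact ConGen.Rel.of _ _ (.left i j (by omega) (by omega))
      · exact ConGen.Rel.of _ _ (.right i j (by omega) (by omega))⟩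
  | _, _, _, .arc x _ _ => ⟨conGen (DiamondRel n (x + 1)), by
      rintro i j (⟨hi, hj⟩ | ⟨hi, hj⟩)
      · exact ConGen.Rel.of _ _ (.left i j (by omega) (by omega))
      · exact ConGen.Rel.of _ _ (.right i j (by omega) (by omega))⟩
  | _, _, _, .arcAbove d hu hv =>
    ⟨Con.ker ((quotHom _ _ (rhoAux d).1 (commuteOutside_mono (by omega) (by omega)
        (rhoAux d).2)).prod (sHom (.arcAbove d hu hv))),
      commuteOutside_ker (.arcAbove d hu hv) _ _⟩
  | _, _, _, .dotLeft d ht hu hv =>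
    ⟨Con.ker ((quotHom _ _ (rhoAux d).1 (commuteOutside_mono (by omega) (by omega)
        (rhoAux d).2)).prod (sHom (.dotLeft d ht hu hv))),
      commuteOutside_ker (.dotLeft d ht hu hv) _ _⟩
  | _, _, _, .dotRight d ht hu hv =>
    ⟨Con.ker ((quotHom _ _ (rhoAux d).1 (commuteOutside_mono (by omega) (by omega)
        (rhoAux d).2)).prod (sHom (.dotRight d ht hu hv))),
      commuteOutside_ker (.dotRight d ht hu hv) _ _⟩

/-- The congruence `ρ(d)` on `M` associated with a vertex `d` of `D`; the root corresponds to the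
trivial congruence. -/
def rho {n : ℕ} : Vertex n → Con (ChineseMonoid n)
  | .root => ⊥
  | .node d => (rhoAux d).1

end ChineseAlgebra

/-! At a leaf the recursively defined congruence collapses to a closed form
(`rhoAux_iff_of_isLeaf`): two elements are related exactly when they have the same multidegree and
the same image in the bicyclic monoid `B` for every arc. The `ℕ`- and `ℤ`-components are functions
of the multidegree. For a leaf beyond the first level the unused generators lie on one side of the
used segment, hence commute modulo the preceding congruence, so the quotient component also depends
on the multidegree only. Conversely the multidegree is recovered from outside inwards
(`rhoAux_le_ker_degHom`). For an extreme arc of the first level the closed form comes from a normal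
form of words (`exists_normalForm_left`, `exists_normalForm_right`).

Such a quotient `S` has a prime algebra. It acts on functions from `ℕ^arcs` to a polynomial ring:
each copy of `B` shifts one coordinate, and the degree multiplies by a monomial. The action is
faithful (`exists_shiftAlgHom_single_ne_zero`). Since the arcs are nested, each one can be isolated
by elements `P`, `Q` acting as `p`, `q` there and trivially at all other arcs (`exists_bHom_eq`).
The elements `P^i (QP - PQ) Q^j` then act as matrix units in one coordinate, up to a monomial, and
their products are matrix units up to a nonzero polynomial. If `x` and `y` are nonzero, a matrix
unit `r` joining a nonzero entry of `x` to one of `y` gives `x r y ≠ 0`, because polynomials form a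
domain. -/

namespace ChineseAlgebra

/-! ### Normal forms in the bicyclic monoid -/

/-- The bicyclic monoid as the set of normal forms `p ^ up * q ^ down`. -/
@[ext]
structure BicyclicPair where
  up : ℕ
  down : ℕ

namespace BicyclicPair

instance : Monoid BicyclicPair where
  -- In `p^i q^j p^k q^l` the middle collapses by `qp = 1` to `p^(k-j)` or `q^(j-k)`; truncated
  -- subtraction covers both cases at once.
  mul a b := ⟨a.up + (b.up - a.down), b.down + (a.down - b.up)⟩
  one := ⟨0, 0⟩
  mul_assoc a b c := BicyclicPair.ext
    (show a.up + (b.up - a.down) + (c.up - (b.down + (a.down - b.up)))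
      = a.up + (b.up + (c.up - b.down) - a.down) by omega)
    (show c.down + (b.down + (a.down - b.up) - c.up)
      = c.down + (b.down - c.up) + (a.down - (b.up + (c.up - b.down))) by omega)
  one_mul a := BicyclicPair.ext (show 0 + (a.up - 0) = a.up by omega)
    (show a.down + (0 - a.up) = a.down by omega)
  mul_one a := BicyclicPair.ext (show a.up + (0 - a.down) = a.up by omega)
    (show 0 + (a.down - 0) = a.down by omega)

theorem up_mul (a b : BicyclicPair) : (a * b).up = a.up + (b.up - a.down) := rfl

theorem down_mul (a b : BicyclicPair) : (a * b).down = b.down + (a.down - b.up) := rfl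

@[simp] theorem up_one : (1 : BicyclicPair).up = 0 := rfl

@[simp] theorem down_one : (1 : BicyclicPair).down = 0 := rfl

theorem p_pow (k : ℕ) : (⟨1, 0⟩ : BicyclicPair) ^ k = ⟨k, 0⟩ := by
  induction k with
  | zero => rfl
  | succ k ih => rw [pow_succ, ih]; ext <;> simp [up_mul, down_mul]

theorem q_pow (k : ℕ) : (⟨0, 1⟩ : BicyclicPair) ^ k = ⟨0, k⟩ := by
  induction k with
  | zero => rfl
  | succ k ih => rw [pow_succ, ih]; ext <;> simp [up_mul, down_mul]; omega

end BicyclicPair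

/-- The normal form of an element of the bicyclic monoid. -/
def Bicyclic.toPair : Bicyclic →* BicyclicPair :=
  PresentedMonoid.lift (fun b => if b then ⟨1, 0⟩ else ⟨0, 1⟩) (by
    rintro _ _ ⟨⟩
    rfl)

@[simp] theorem Bicyclic.toPair_p : Bicyclic.toPair Bicyclic.p = ⟨1, 0⟩ := rfl

@[simp] theorem Bicyclic.toPair_q : Bicyclic.toPair Bicyclic.q = ⟨0, 1⟩ := rfl

theorem Bicyclic.q_pow_mul_p (k : ℕ) : Bicyclic.q ^ (k + 1) * Bicyclic.p = Bicyclic.q ^ k := by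
  rw [pow_succ, mul_assoc, Bicyclic.q_mul_p, mul_one]

/-- Right multiplication by a generator keeps the shape `p^i q^j`: `q` lengthens the second block,
while `p` cancels a `q` or, if there is none, lengthens the first block. This makes `toPair`
faithful. -/
theorem Bicyclic.eq_p_pow_mul_q_pow (b : Bicyclic) :
    b = Bicyclic.p ^ (Bicyclic.toPair b).up * Bicyclic.q ^ (Bicyclic.toPair b).down := by
  have hb : b ∈ Submonoid.closure (Set.range (PresentedMonoid.of BicyclicRel)) := by
    rw [PresentedMonoid.closure_range_of]; trivial
  induction hb using Submonoid.closure_induction_right with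
  | one => simp
  | mul_right x hx y hy ih =>
    obtain ⟨c, rfl⟩ := hy
    cases c with
    | false =>
      change x * Bicyclic.q = _
      rw [map_mul]
      change _ = Bicyclic.p ^ (Bicyclic.toPair x * ⟨0, 1⟩).up *
        Bicyclic.q ^ (Bicyclic.toPair x * ⟨0, 1⟩).down
      nth_rewrite 1 [ih]
      rw [BicyclicPair.up_mul, BicyclicPair.down_mul, mul_assoc, ← pow_succ]
      change _ = Bicyclic.p ^ ((Bicyclic.toPair x).up + (0 - (Bicyclic.toPair x).down)) *
        Bicyclic.q ^ (1 + ((Bicyclic.toPair x).down - 0))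
      rw [Nat.zero_sub, add_zero, Nat.sub_zero, add_comm 1]
    | true =>
      change x * Bicyclic.p = _
      rw [map_mul]
      change _ = Bicyclic.p ^ (Bicyclic.toPair x * ⟨1, 0⟩).up *
        Bicyclic.q ^ (Bicyclic.toPair x * ⟨1, 0⟩).down
      nth_rewrite 1 [ih]
      rw [BicyclicPair.up_mul, BicyclicPair.down_mul]
      rcases (Bicyclic.toPair x).down with _ | k
      · simp [pow_succ]
      · simp [mul_assoc, Bicyclic.q_pow_mul_p]

theorem Bicyclic.toPair_injective : Function.Injective Bicyclic.toPair := fun a b h => by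
  rw [a.eq_p_pow_mul_q_pow, b.eq_p_pow_mul_q_pow, h]

/-! ### Primeness of congruence ideals and monoid algebras of the quotient -/

theorem mem_congIdeal {K : Type*} [Field K] {S : Type*} [Monoid S] (ρ : Con S)
    (x : MonoidAlgebra K S) : x ∈ congIdeal K ρ ↔ x ∈ congSpan K ρ :=
  TwoSidedIdeal.mem_mk' ..

/-- This identifies the ideal with the kernel of `K[S] → K[S/ρ]`, so that primeness can be tested in
the algebra of the quotient. -/
theorem mem_congIdeal_iff {K : Type*} [Field K] {S : Type*} [Monoid S] (ρ : Con S)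
    (x : MonoidAlgebra K S) :
    x ∈ congIdeal K ρ ↔ MonoidAlgebra.mapDomainAlgHom K K ρ.mk' x = 0 := by
  rw [mem_congIdeal]
  constructor
  · intro hx
    refine Submodule.span_induction
      (p := fun x _ => MonoidAlgebra.mapDomainAlgHom K K ρ.mk' x = 0) ?_ ?_ ?_ ?_ hx
    · rintro _ ⟨s, t, hst, rfl⟩
      have : (s : ρ.Quotient) = t := (Con.eq ρ).2 hst
      rw [map_sub, sub_eq_zero]
      simpa [MonoidAlgebra.mapDomain_single] using congrArg (MonoidAlgebra.single · 1) this
    · exact map_zero _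
    · intro a b _ _ ha hb; rw [map_add, ha, hb, add_zero]
    · intro c a _ ha; rw [map_smul, ha, smul_zero]
  · intro hx
    obtain ⟨σ, hσ⟩ := (Con.mk'_surjective (c := ρ)).hasRightInverse
    -- Replacing every monoid element by the chosen representative of its class changes `z` only by
    -- an element of the span.
    have key : ∀ z : MonoidAlgebra K S, z - MonoidAlgebra.mapDomain σ
        (MonoidAlgebra.mapDomainAlgHom K K ρ.mk' z) ∈ congSpan K ρ := by
      intro z
      induction z using MonoidAlgebra.induction_linear with
      | zero => simp
      | add f g hf hg =>
        rw [map_add, MonoidAlgebra.mapDomain_add, add_sub_add_comm]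
        exact Submodule.add_mem _ hf hg
      | single m r =>
        have h1 : ρ m (σ (m : ρ.Quotient)) := ρ.symm ((Con.eq ρ).1 (hσ m))
        have h2 := Submodule.smul_mem (congSpan K ρ) r (Submodule.subset_span ⟨_, _, h1, rfl⟩)
        simpa [smul_sub, MonoidAlgebra.mapDomain_single] using h2
    have := key x
    rwa [hx, MonoidAlgebra.mapDomain_zero, sub_zero] at this

theorem isPrimeIdeal_congIdeal_of_quotient {K : Type*} [Field K] {S : Type*} [Monoid S] (ρ : Con S)
    (h : ∀ x y : MonoidAlgebra K ρ.Quotient, (∀ r, x * r * y = 0) → x = 0 ∨ y = 0) :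
    IsPrimeIdeal (congIdeal K ρ) := by
  refine ⟨fun htop => ?_, fun x y hxy => ?_⟩
  · have h1 : (1 : MonoidAlgebra K S) ∈ congIdeal K ρ := htop ▸ trivial
    rw [mem_congIdeal_iff, map_one] at h1
    exact one_ne_zero h1
  · simp only [mem_congIdeal_iff] at hxy ⊢
    refine h _ _ fun r => ?_
    obtain ⟨r', rfl⟩ : ∃ r', MonoidAlgebra.mapDomainAlgHom K K ρ.mk' r' = r := by
      induction r using MonoidAlgebra.induction_linear with
      | zero => exact ⟨0, map_zero _⟩
      | add f g hf hg =>
        obtain ⟨a, rfl⟩ := hf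
        obtain ⟨b, rfl⟩ := hg
        exact ⟨a + b, map_add _ _ _⟩
      | single m c =>
        obtain ⟨s, rfl⟩ := Con.mk'_surjective m
        exact ⟨.single s c, by simp [MonoidAlgebra.mapDomain_single]⟩
    rw [← map_mul, ← map_mul]
    exact hxy r'

/-! ### Monoids graded by a free commutative monoid and mapped to copies of the bicyclic monoid -/

section Shift

variable {S ι σ : Type*} [Monoid S] (K : Type*) [Field K]
  (D : S →* Multiplicative (σ →₀ ℕ)) (β : ι → S →* BicyclicPair)

open Classical in
/-- The action of `S` on functions on `ι → ℕ`: the `a`-th component of `S` in the bicyclic monoid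
shifts the `a`-th coordinate, and the grading acts by multiplication by monomials. -/
noncomputable def shiftRep :
    S →* Module.End (MvPolynomial σ K) ((ι → ℕ) → MvPolynomial σ K) where
  toFun s :=
    { toFun f m := if ∀ a, (β a s).up ≤ m a then
        MvPolynomial.monomial (D s).toAdd 1 * f (fun a => m a - (β a s).up + (β a s).down) else 0
      map_add' f g := by
        ext1 m
        simp only [Pi.add_apply]
        split_ifs <;> simp [mul_add]
      map_smul' r f := by
        ext1 m
        simp only [Pi.smul_apply, RingHom.id_apply, smul_eq_mul]
        split_ifs
        · ring
        · simp }
  map_one' := by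
    ext1 f; ext1 m
    simp
  map_mul' s t := by
    ext1 f; ext1 m
    simp only [LinearMap.coe_mk, AddHom.coe_mk, Module.End.mul_apply, map_mul,
      BicyclicPair.up_mul, BicyclicPair.down_mul]
    -- The product is defined at `m` exactly when `s` is defined at `m` and `t` is defined at the
    -- point to which `s` moves `m`.
    by_cases h1 : ∀ a, (β a s).up ≤ m a
    · rw [if_pos h1]
      by_cases h2 : ∀ a, (β a t).up ≤ m a - (β a s).up + (β a s).down
      · rw [if_pos h2, if_pos (fun a => by have := h1 a; have := h2 a; omega), ← mul_assoc,
          MvPolynomial.monomial_mul, one_mul, toAdd_mul]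
        congr 2
        ext1 a
        have := h1 a
        have := h2 a
        omega
      · rw [if_neg h2, mul_zero, if_neg]
        exact fun h => h2 fun a => by have := h1 a; have := h a; omega
    · rw [if_neg h1, if_neg]
      exact fun h => h1 fun a => by have := h a; omega

open Classical in
theorem shiftRep_apply (s : S) (f : (ι → ℕ) → MvPolynomial σ K) (m : ι → ℕ) :
    shiftRep K D β s f m = if ∀ a, (β a s).up ≤ m a then
      MvPolynomial.monomial (D s).toAdd 1 * f (fun a => m a - (β a s).up + (β a s).down)
      else 0 := rfl

/-- The linear extension of `shiftRep` to the monoid algebra. -/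
noncomputable def shiftAlgHom :
    MonoidAlgebra K S →ₐ[K] Module.End (MvPolynomial σ K) ((ι → ℕ) → MvPolynomial σ K) :=
  MonoidAlgebra.lift K _ S (shiftRep K D β)

theorem shiftAlgHom_of (s : S) :
    shiftAlgHom K D β (MonoidAlgebra.of K S s) = shiftRep K D β s :=
  MonoidAlgebra.lift_of _ _

theorem shiftAlgHom_apply (x : MonoidAlgebra K S) (f : (ι → ℕ) → MvPolynomial σ K) (m : ι → ℕ) :
    shiftAlgHom K D β x f m = ∑ s ∈ x.coeff.support, x.coeff s • shiftRep K D β s f m := by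
  rw [shiftAlgHom, MonoidAlgebra.lift_apply, Finsupp.sum, LinearMap.sum_apply, Finset.sum_apply]
  rfl

open Classical in
-- Among the elements of the support take `s` with the least total `down`, and look at the entry
-- from `down s` to `up s`, in the coefficient of degree `D s`. Another `t` contributing there has
-- `down t ≤ down s` in every coordinate, so by minimality `down t = down s`; then `up t = up s`,
-- and separation of points forces `t = s`.
theorem exists_shiftAlgHom_single_ne_zero [Fintype ι]
    (hinj : ∀ s t, D s = D t → (∀ a, β a s = β a t) → s = t)
    (x : MonoidAlgebra K S) (hx : x ≠ 0) :
    ∃ m k : ι → ℕ, shiftAlgHom K D β x (Pi.single k 1) m ≠ 0 := by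
  have hne : x.coeff.support.Nonempty := by
    rw [Finsupp.support_nonempty_iff]
    exact fun h => hx (by cases x; simp_all)
  obtain ⟨s, hs, hmin⟩ := Finset.exists_min_image _ (fun s => ∑ a, (β a s).down) hne
  refine ⟨fun a => (β a s).up, fun a => (β a s).down, fun h0 => ?_⟩
  have h1 := congrArg (MvPolynomial.coeff (D s).toAdd) h0
  rw [shiftAlgHom_apply, MvPolynomial.coeff_sum, MvPolynomial.coeff_zero,
    Finset.sum_eq_single_of_mem s hs] at h1
  · rw [shiftRep_apply, if_pos (fun _ => le_rfl)] at h1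
    simp at h1
    exact (Finsupp.mem_support_iff.1 hs) h1
  · intro t ht hts
    rw [shiftRep_apply, MvPolynomial.coeff_smul]
    split_ifs with hup
    · rw [Pi.single_apply]
      split_ifs with hk
      · rw [mul_one, MvPolynomial.coeff_monomial, if_neg, smul_zero]
        intro hD
        have hle : ∀ a ∈ Finset.univ, (β a t).down ≤ (β a s).down := fun a _ => by
          have := congrFun hk a
          have := hup a
          omega
        have heq := (Finset.sum_eq_sum_iff_of_le hle).1
          (le_antisymm (Finset.sum_le_sum hle) (hmin t ht))
        refine hts (hinj t s (Multiplicative.toAdd.injective hD) fun a => ?_)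
        have h2 := heq a (Finset.mem_univ _)
        have h3 := congrFun hk a
        have h4 := hup a
        exact BicyclicPair.ext (by omega) h2
      · simp
    · simp

open Classical in
theorem exists_shiftAlgHom_eq_matrixUnit_coord (a : ι) (P Q : S) (hP : β a P = ⟨1, 0⟩)
    (hQ : β a Q = ⟨0, 1⟩)
    (hPQ : ∀ b, b ≠ a → β b P = 1 ∧ β b Q = 1) (i j : ℕ) :
    ∃ (r : MonoidAlgebra K S) (z : MvPolynomial σ K), z ≠ 0 ∧ ∀ f m,
      shiftAlgHom K D β r f m = if m a = i then z * f (Function.update m a j) else 0 := by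
  -- In the shift action `1 - pq` projects onto coordinate value `0`, so `p^i (1 - pq) q^j` is a
  -- matrix unit. Writing `1` as `QP` gives both terms the same degree, hence a common monomial
  -- factor.
  refine ⟨MonoidAlgebra.of K S (P ^ i * (Q * P) * Q ^ j)
    - MonoidAlgebra.of K S (P ^ i * (P * Q) * Q ^ j),
    MvPolynomial.monomial (D (P ^ i * (P * Q) * Q ^ j)).toAdd 1, by simp, fun f m => ?_⟩
  have hD : D (P ^ i * (Q * P) * Q ^ j) = D (P ^ i * (P * Q) * Q ^ j) := by
    simp only [map_mul]
    rw [mul_comm (D Q)]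
  have e1 : β a (P ^ i * (Q * P) * Q ^ j) = ⟨i, j⟩ := by
    simp only [map_mul, map_pow, hP, hQ, BicyclicPair.p_pow, BicyclicPair.q_pow]
    ext <;> simp [BicyclicPair.up_mul, BicyclicPair.down_mul]
  have e2 : β a (P ^ i * (P * Q) * Q ^ j) = ⟨i + 1, j + 1⟩ := by
    simp only [map_mul, map_pow, hP, hQ, BicyclicPair.p_pow, BicyclicPair.q_pow]
    ext <;> simp [BicyclicPair.up_mul, BicyclicPair.down_mul]
  have f1 : ∀ b, b ≠ a → β b (P ^ i * (Q * P) * Q ^ j) = 1 := fun b hb => by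
    simp [hPQ b hb]
  have f2 : ∀ b, b ≠ a → β b (P ^ i * (P * Q) * Q ^ j) = 1 := fun b hb => by
    simp [hPQ b hb]
  have up1 : (∀ b, (β b (P ^ i * (Q * P) * Q ^ j)).up ≤ m b) ↔ i ≤ m a :=
    ⟨fun h => by simpa [e1] using h a, fun h b => by
      by_cases hb : b = a
      · subst hb; simpa [e1] using h
      · simp [f1 b hb]⟩
  have up2 : (∀ b, (β b (P ^ i * (P * Q) * Q ^ j)).up ≤ m b) ↔ i + 1 ≤ m a :=
    ⟨fun h => by simpa [e2] using h a, fun h b => by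
      by_cases hb : b = a
      · subst hb; simpa [e2] using h
      · simp [f2 b hb]⟩
  have arg1 : (fun b => m b - (β b (P ^ i * (Q * P) * Q ^ j)).up
      + (β b (P ^ i * (Q * P) * Q ^ j)).down) = Function.update m a (m a - i + j) := by
    ext b
    by_cases hb : b = a
    · subst hb; simp [e1]
    · simp [f1 b hb, hb]
  have arg2 : (fun b => m b - (β b (P ^ i * (P * Q) * Q ^ j)).up
      + (β b (P ^ i * (P * Q) * Q ^ j)).down) =
      Function.update m a (m a - (i + 1) + (j + 1)) := by
    ext b
    by_cases hb : b = a
    · subst hb; simp [e2]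
    · simp [f2 b hb, hb]
  rw [map_sub, LinearMap.sub_apply, Pi.sub_apply, shiftAlgHom_of, shiftAlgHom_of,
    shiftRep_apply, shiftRep_apply, arg1, arg2, hD]
  simp only [up1, up2]
  rcases lt_trichotomy (m a) i with h | h | h
  · rw [if_neg (by omega), if_neg (by omega), if_neg (by omega), sub_zero]
  · rw [if_pos (by omega), if_neg (by omega), if_pos h, sub_zero, h]
    simp
  · rw [if_pos (by omega), if_pos (by omega), if_neg (by omega),
      show m a - i + j = m a - (i + 1) + (j + 1) by omega, sub_self]

open Classical in
theorem exists_shiftAlgHom_eq_matrixUnit [Fintype ι]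
    (hPQ : ∀ a, ∃ P Q : S, β a P = ⟨1, 0⟩ ∧ β a Q = ⟨0, 1⟩ ∧
      ∀ b, b ≠ a → β b P = 1 ∧ β b Q = 1) (i j : ι → ℕ) :
    ∃ (r : MonoidAlgebra K S) (z : MvPolynomial σ K), z ≠ 0 ∧ ∀ f m,
      shiftAlgHom K D β r f m = if m = i then z * f j else 0 := by
  -- One coordinate at a time: a product of one-coordinate matrix units fixes the coordinates in `T`
  -- and leaves the others free.
  have key : ∀ T : Finset ι, ∃ (r : MonoidAlgebra K S) (z : MvPolynomial σ K), z ≠ 0 ∧ ∀ f m,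
      shiftAlgHom K D β r f m =
        if ∀ a ∈ T, m a = i a then z * f (fun a => if a ∈ T then j a else m a) else 0 := by
    intro T
    induction T using Finset.induction_on with
    | empty => exact ⟨1, 1, one_ne_zero, fun f m => by simp⟩
    | insert a T haT ih =>
      obtain ⟨r, z, hz, hr⟩ := ih
      obtain ⟨P, Q, h1, h2, h3⟩ := hPQ a
      obtain ⟨r', z', hz', hr'⟩ :=
        exists_shiftAlgHom_eq_matrixUnit_coord K D β a P Q h1 h2 h3 (i a) (j a)
      refine ⟨r' * r, z' * z, mul_ne_zero hz' hz, fun f m => ?_⟩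
      rw [map_mul, Module.End.mul_apply, hr', hr]
      have hne : ∀ b ∈ T, b ≠ a := fun b hb h => haT (h ▸ hb)
      have hiff : (∀ b ∈ T, Function.update m a (j a) b = i b) ↔ ∀ b ∈ T, m b = i b :=
        forall₂_congr fun b hb => by rw [Function.update_of_ne (hne b hb)]
      have hfun : (fun b => if b ∈ T then j b else Function.update m a (j a) b) =
          fun b => if b ∈ insert a T then j b else m b := by
        ext b
        by_cases hb : b = a
        · subst hb; simp [haT]
        · simp [hb]
      simp only [hiff, hfun, Finset.forall_mem_insert]
      by_cases hA : m a = i a <;> by_cases hB : ∀ b ∈ T, m b = i b <;> simp [hA, hB, mul_assoc]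
  obtain ⟨r, z, hz, hr⟩ := key Finset.univ
  refine ⟨r, z, hz, fun f m => ?_⟩
  rw [hr]
  simp [funext_iff]

/-- If the grading and the maps to the bicyclic monoid separate the points of `S`, and each copy of
the bicyclic monoid is attained in the image up to the grading, then `K[S]` is a prime ring. -/
theorem eq_zero_or_eq_zero_of_forall_mul_mul_eq_zero [Finite ι]
    (hinj : ∀ s t, D s = D t → (∀ a, β a s = β a t) → s = t)
    (hPQ : ∀ a, ∃ P Q : S, β a P = ⟨1, 0⟩ ∧ β a Q = ⟨0, 1⟩ ∧
      ∀ b, b ≠ a → β b P = 1 ∧ β b Q = 1)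
    (x y : MonoidAlgebra K S) (hxy : ∀ r, x * r * y = 0) : x = 0 ∨ y = 0 := by
  classical
  have := Fintype.ofFinite ι
  by_contra! hne
  obtain ⟨m, k, hx⟩ := exists_shiftAlgHom_single_ne_zero K D β hinj x hne.1
  obtain ⟨m', k', hy⟩ := exists_shiftAlgHom_single_ne_zero K D β hinj y hne.2
  obtain ⟨r, z, hz, hr⟩ := exists_shiftAlgHom_eq_matrixUnit K D β hPQ k m'
  have h0 : shiftAlgHom K D β (x * r * y) (Pi.single k' 1) m = 0 := by
    rw [hxy, map_zero]; rfl
  rw [map_mul, map_mul, Module.End.mul_apply, Module.End.mul_apply] at h0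
  set w := shiftAlgHom K D β y (Pi.single k' 1) with hw
  -- The matrix unit sends `w` to a scalar multiple of the basis function at `k`, the one on which
  -- `x` is known to be nonzero.
  have h1 : shiftAlgHom K D β r w = (z * w m') • Pi.single k 1 := by
    ext1 l
    rw [hr, Pi.smul_apply, Pi.single_apply]
    split_ifs <;> simp
  rw [h1, map_smul, Pi.smul_apply, smul_eq_mul] at h0
  exact mul_ne_zero (mul_ne_zero hz hy) hx h0

end Shift

/-- A criterion for the ideal given by a congruence to be prime. -/
theorem isPrimeIdeal_congIdeal {K : Type*} [Field K] {S : Type*} [Monoid S] {ι σ : Type*}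
    [Finite ι] (ρ : Con S)
    (D : S →* Multiplicative (σ →₀ ℕ)) (β : ι → S →* BicyclicPair)
    (hρ : ∀ s t, ρ s t ↔ D s = D t ∧ ∀ a, β a s = β a t)
    (hPQ : ∀ a, ∃ P Q : S, β a P = ⟨1, 0⟩ ∧ β a Q = ⟨0, 1⟩ ∧
      ∀ b, b ≠ a → β b P = 1 ∧ β b Q = 1) :
    IsPrimeIdeal (congIdeal K ρ) := by
  refine isPrimeIdeal_congIdeal_of_quotient ρ
    (eq_zero_or_eq_zero_of_forall_mul_mul_eq_zero K
      (ρ.lift D fun s t h => ((hρ s t).1 h).1)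
      (fun a => ρ.lift (β a) fun s t h => ((hρ s t).1 h).2 a) ?_ ?_)
  · intro s t
    obtain ⟨s, rfl⟩ := Con.mk'_surjective s
    obtain ⟨t, rfl⟩ := Con.mk'_surjective t
    intro h1 h2
    exact (Con.eq ρ).2 ((hρ s t).2 ⟨h1, h2⟩)
  · intro a
    obtain ⟨P, Q, h1, h2, h3⟩ := hPQ a
    exact ⟨P, Q, h1, h2, h3⟩

/-! ### Homomorphisms out of the Chinese monoid and degrees -/

variable {n : ℕ}

theorem exists_prod_map_gen_eq (s : ChineseMonoid n) :
    ∃ w : List (Idx n), (w.map gen).prod = s := by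
  have hs : s ∈ Submonoid.closure (Set.range (PresentedMonoid.of (ChineseRel n))) := by
    rw [PresentedMonoid.closure_range_of]; trivial
  induction hs using Submonoid.closure_induction with
  | mem x hx =>
    obtain ⟨i, rfl⟩ := hx
    exact ⟨[i], by simp [gen]⟩
  | one => exact ⟨[], rfl⟩
  | mul x y _ _ hx hy =>
    obtain ⟨w, rfl⟩ := hx
    obtain ⟨w', rfl⟩ := hy
    exact ⟨w ++ w', by simp⟩

theorem map_prod_map_gen {T : Type*} [Monoid T] (f : ChineseMonoid n →* T) (w : List (Idx n)) :
    f (w.map gen).prod = (w.map fun i => f (gen i)).prod := by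
  rw [map_list_prod, List.map_map]; rfl

theorem hom_ext {T : Type*} [Monoid T] {f g : ChineseMonoid n →* T}
    (h : ∀ i, f (gen i) = g (gen i)) : f = g := by
  refine MonoidHom.ext fun s => ?_
  obtain ⟨w, rfl⟩ := exists_prod_map_gen_eq s
  simp only [map_prod_map_gen, h]

/-- The multidegree of an element of the Chinese monoid. -/
noncomputable def degHom (n : ℕ) : ChineseMonoid n →* Multiplicative (Idx n →₀ ℕ) :=
  liftHom (fun l => Multiplicative.ofAdd (Finsupp.single l 1))
    (fun _ _ _ _ _ => ⟨by ac_rfl, by ac_rfl⟩)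

theorem degHom_gen (i : Idx n) :
    degHom n (gen i) = Multiplicative.ofAdd (Finsupp.single i 1) := rfl

theorem degHom_prod_map_gen (w : List (Idx n)) (i : Idx n) :
    (degHom n (w.map gen).prod).toAdd i = w.count i := by
  induction w with
  | nil => simp
  | cons j w ih =>
    rw [List.map_cons, List.prod_cons, map_mul, toAdd_mul, Finsupp.add_apply, ih, degHom_gen,
      toAdd_ofAdd, Finsupp.single_apply, List.count_cons, add_comm]
    simp [Subtype.ext_iff]

theorem perm_of_degHom_eq {w w' : List (Idx n)}
    (h : degHom n (w.map gen).prod = degHom n (w'.map gen).prod) : w.Perm w' := by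
  rw [List.perm_iff_count]
  intro i
  rw [← degHom_prod_map_gen, ← degHom_prod_map_gen, h]

/-- Words of equal multidegree are permutations of each other, and a homomorphism with commuting
values on the generators ignores the order of letters. -/
theorem map_eq_of_degHom_eq {T : Type*} [Monoid T] (f : ChineseMonoid n →* T)
    (hf : ∀ i j, Commute (f (gen i)) (f (gen j))) {s t : ChineseMonoid n}
    (h : degHom n s = degHom n t) : f s = f t := by
  obtain ⟨w, rfl⟩ := exists_prod_map_gen_eq s
  obtain ⟨w', rfl⟩ := exists_prod_map_gen_eq t
  rw [map_prod_map_gen, map_prod_map_gen]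
  refine ((perm_of_degHom_eq h).map _).prod_eq' ?_
  exact List.pairwise_map.2 (List.pairwise_of_forall fun i j => hf i j)

theorem toAdd_map_eq_sum_degHom (f : ChineseMonoid n →* Multiplicative ℤ) (s : ChineseMonoid n) :
    (f s).toAdd = (degHom n s).toAdd.sum fun l k => (k : ℤ) * (f (gen l)).toAdd := by
  obtain ⟨w, rfl⟩ := exists_prod_map_gen_eq s
  induction w with
  | nil => simp
  | cons j w ih =>
    rw [List.map_cons, List.prod_cons, map_mul f, map_mul (degHom n), toAdd_mul, toAdd_mul, ih,
      degHom_gen, toAdd_ofAdd, Finsupp.sum_add_index' (by simp) (by intros; push_cast; ring),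
      Finsupp.sum_single_index (by simp)]
    simp

/-- A homomorphism to `ℤ` is a linear form in the multidegree. If every other generator has zero
weight or known degree, the equation leaves only the term of `y`. -/
theorem degHom_apply_eq_of_map_eq (f : ChineseMonoid n →* Multiplicative ℤ) {s t : ChineseMonoid n}
    (y : Idx n) (hy : f (gen y) ≠ 1) (hst : f s = f t)
    (h : ∀ l, l ≠ y → f (gen l) = 1 ∨ (degHom n s).toAdd l = (degHom n t).toAdd l) :
    (degHom n s).toAdd y = (degHom n t).toAdd y := by
  classical
  have h1 := congrArg Multiplicative.toAdd hst
  rw [toAdd_map_eq_sum_degHom, toAdd_map_eq_sum_degHom,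
    Finsupp.sum_of_support_subset _ (Finset.subset_union_left
      (s₂ := (degHom n t).toAdd.support)) _ (by simp),
    Finsupp.sum_of_support_subset _ (Finset.subset_union_right
      (s₁ := (degHom n s).toAdd.support)) _ (by simp), ← sub_eq_zero, ← Finset.sum_sub_distrib,
    Finset.sum_eq_single y] at h1
  · rw [← sub_mul, mul_eq_zero, sub_eq_zero] at h1
    rcases h1 with h1 | h1
    · exact_mod_cast h1
    · exact absurd (Multiplicative.toAdd.injective h1) hy
  · intro l _ hl
    rcases h l hl with h | h
    · simp [h]
    · simp [h]
  · intro hy'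
    rw [Finset.notMem_union, Finsupp.notMem_support_iff, Finsupp.notMem_support_iff] at hy'
    simp [hy'.1, hy'.2]

/-! ### The arcs of a diagram -/

/-- The set of pairs `(x, y)`, `x < y`, such that `a_y a_x` is an arc of the diagram. -/
def arcs : {t : Step} → {u v : ℕ} → Diagram n t u v → Finset (ℕ × ℕ)
  | _, _, _, .dot _ _ _ => ∅
  | _, _, _, .arc x _ _ => {(x, x + 1)}
  | _, u, _, .arcAbove (v := v) d _ _ => insert (u, v + 1) (arcs d)
  | _, _, _, .dotLeft d _ _ _ => arcs d
  | _, _, _, .dotRight d _ _ _ => arcs d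

theorem bounds_of_mem_arcs {t : Step} {u v : ℕ} (d : Diagram n t u v) {a : ℕ × ℕ}
    (ha : a ∈ arcs d) : u ≤ a.1 ∧ a.1 < a.2 ∧ a.2 ≤ v := by
  induction d with
  | dot s hs hsn => simp [arcs] at ha
  | arc x hx hxn =>
    rw [arcs, Finset.mem_singleton] at ha
    subst ha
    simp
  | arcAbove d hu hv ih =>
    have := d.le
    rw [arcs, Finset.mem_insert] at ha
    rcases ha with rfl | ha
    · simp only; omega
    · have := ih ha; omega
  | dotLeft d ht hu hv ih => have := ih ha; omega
  | dotRight d ht hu hv ih => have := ih ha; omega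

/-- The component in the bicyclic monoid of the homomorphism associated with an arc. -/
def bHom (n : ℕ) (a : ℕ × ℕ) : ChineseMonoid n →* Bicyclic :=
  (MonoidHom.fst _ _).comp (arcHom n a.1 a.2)

theorem bHom_gen (a : ℕ × ℕ) (i : Idx n) : bHom n a (gen i) = arcVal a.1 a.2 i.1 := rfl

theorem bHom_gen_of_le {a : ℕ × ℕ} {i : Idx n} (h : i.1 ≤ a.1) :
    bHom n a (gen i) = Bicyclic.p := by
  rw [bHom_gen, arcVal, if_pos h]

theorem bHom_gen_of_ge {a : ℕ × ℕ} {i : Idx n} (ha : a.1 < a.2) (h : a.2 ≤ i.1) :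
    bHom n a (gen i) = Bicyclic.q := by
  rw [bHom_gen, arcVal, if_neg (by omega), if_pos h]

theorem bHom_gen_of_mem {a : ℕ × ℕ} {i : Idx n} (h1 : a.1 < i.1) (h2 : i.1 < a.2) :
    bHom n a (gen i) = 1 := by
  rw [bHom_gen, arcVal, if_neg (by omega), if_neg (by omega)]

/-- The second half is the isolation of single arcs; the first half, a pair acting as `p`, `q` at
all arcs simultaneously, is carried along to feed the induction. The clauses on surrounding arcs say
that these elements remain invisible to arcs added later. -/
theorem exists_bHom_eq {t : Step} {u v : ℕ} (d : Diagram n t u v) :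
    (∃ P Q : ChineseMonoid n, (∀ a ∈ arcs d, bHom n a P = Bicyclic.p ∧ bHom n a Q = Bicyclic.q) ∧
      ∀ a : ℕ × ℕ, a.1 < u → v < a.2 → bHom n a P = 1 ∧ bHom n a Q = 1) ∧
    ∀ a ∈ arcs d, ∃ P Q : ChineseMonoid n, bHom n a P = Bicyclic.p ∧ bHom n a Q = Bicyclic.q ∧
      (∀ b ∈ arcs d, b ≠ a → bHom n b P = 1 ∧ bHom n b Q = 1) ∧
      ∀ b : ℕ × ℕ, b.1 < u → v < b.2 → bHom n b P = 1 ∧ bHom n b Q = 1 := by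
  induction d with
  | dot s hs hsn =>
    exact ⟨⟨1, 1, by simp [arcs], by simp⟩, by simp [arcs]⟩
  | arc x hx hxn =>
    have hP : bHom n (x, x + 1) (gen ⟨x, by omega⟩) = Bicyclic.p := bHom_gen_of_le le_rfl
    have hQ : bHom n (x, x + 1) (gen ⟨x + 1, by omega⟩) = Bicyclic.q :=
      bHom_gen_of_ge (Nat.lt_succ_self x) le_rfl
    have hout : ∀ b : ℕ × ℕ, b.1 < x → x + 1 < b.2 → bHom n b (gen ⟨x, by omega⟩) = 1 ∧
        bHom n b (gen ⟨x + 1, by omega⟩) = 1 := fun b h1 h2 =>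
      ⟨bHom_gen_of_mem h1 (by simp only; omega), bHom_gen_of_mem (by simp only; omega) h2⟩
    simp only [arcs, Finset.mem_singleton, forall_eq]
    exact ⟨⟨_, _, ⟨hP, hQ⟩, hout⟩, _, _, hP, hQ, fun hne => absurd rfl hne, hout⟩
  | @arcAbove t u v d hu hv ih =>
    obtain ⟨⟨P, Q, hPQ, hPQ'⟩, ih⟩ := ih
    have hle := d.le
    have hP : ∀ b ∈ arcs d, bHom n b (gen ⟨u, by omega⟩) = Bicyclic.p := fun b hb =>
      bHom_gen_of_le (by have := bounds_of_mem_arcs d hb; simp only; omega)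
    have hQ : ∀ b ∈ arcs d, bHom n b (gen ⟨v + 1, by omega⟩) = Bicyclic.q := fun b hb => by
      have := bounds_of_mem_arcs d hb
      exact bHom_gen_of_ge (by omega) (by simp only; omega)
    have hP0 : bHom n (u, v + 1) (gen ⟨u, by omega⟩) = Bicyclic.p := bHom_gen_of_le le_rfl
    have hQ0 : bHom n (u, v + 1) (gen ⟨v + 1, by omega⟩) = Bicyclic.q :=
      bHom_gen_of_ge (by simp only; omega) le_rfl
    have hout : ∀ b : ℕ × ℕ, b.1 < u → v + 1 < b.2 → bHom n b (gen ⟨u, by omega⟩) = 1 ∧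
        bHom n b (gen ⟨v + 1, by omega⟩) = 1 := fun b h1 h2 =>
      ⟨bHom_gen_of_mem h1 (by simp only; omega), bHom_gen_of_mem (by simp only; omega) h2⟩
    simp only [arcs, Finset.forall_mem_insert]
    -- To isolate the new arc, the action of its end generators on the inner arcs is cancelled by
    -- the inner pair. The order of the factors matters: at the inner arcs both products become `qp
    -- = 1`, whereas `pq` is not `1`.
    refine ⟨⟨_, _, ⟨⟨hP0, hQ0⟩, fun b hb => ⟨hP b hb, hQ b hb⟩⟩, hout⟩,
      ⟨Q * gen ⟨u, by omega⟩, gen ⟨v + 1, by omega⟩ * P, ?_, ?_, ⟨by simp, fun b hb _ => ?_⟩,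
        fun b h1 h2 => ?_⟩, fun a ha => ?_⟩
    · rw [map_mul, hP0, (hPQ' (u, v + 1) (by simp) (by simp)).2, one_mul]
    · rw [map_mul, hQ0, (hPQ' (u, v + 1) (by simp) (by simp)).1, mul_one]
    · rw [map_mul, map_mul, hP b hb, hQ b hb, (hPQ b hb).1, (hPQ b hb).2, Bicyclic.q_mul_p]
      exact ⟨rfl, rfl⟩
    · rw [map_mul, map_mul, (hPQ' b (by omega) (by omega)).1, (hPQ' b (by omega) (by omega)).2,
        (hout b h1 h2).1, (hout b h1 h2).2]
      exact ⟨one_mul _, one_mul _⟩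
    · obtain ⟨P', Q', h1, h2, h3, h4⟩ := ih a ha
      exact ⟨P', Q', h1, h2, ⟨fun _ => h4 _ (by simp) (by simp), h3⟩,
        fun b hb hb' => h4 b (by omega) (by omega)⟩
  | dotLeft d ht hu hv ih =>
    obtain ⟨⟨P, Q, hPQ, hPQ'⟩, ih⟩ := ih
    refine ⟨⟨P, Q, hPQ, fun b h1 h2 => hPQ' b (by omega) h2⟩, fun a ha => ?_⟩
    obtain ⟨P', Q', h1, h2, h3, h4⟩ := ih a ha
    exact ⟨P', Q', h1, h2, h3, fun b hb hb' => h4 b (by omega) hb'⟩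
  | dotRight d ht hu hv ih =>
    obtain ⟨⟨P, Q, hPQ, hPQ'⟩, ih⟩ := ih
    refine ⟨⟨P, Q, hPQ, fun b h1 h2 => hPQ' b h1 (by omega)⟩, fun a ha => ?_⟩
    obtain ⟨P', Q', h1, h2, h3, h4⟩ := ih a ha
    exact ⟨P', Q', h1, h2, h3, fun b hb hb' => h4 b hb (by omega)⟩

/-! ### Degrees and arc components determine, and are determined by, `sHom` -/

theorem bHom_eq_of_sHom_eq {t : Step} {u v : ℕ} (d : Diagram n t u v) {r s : ChineseMonoid n}
    (h : sHom d r = sHom d s) : ∀ a ∈ arcs d, bHom n a r = bHom n a s := by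
  induction d with
  | dot s hs hsn => simp [arcs]
  | arc x hx hxn =>
    simp only [arcs, Finset.mem_singleton, forall_eq]
    exact congrArg Prod.fst h
  | arcAbove d hu hv ih =>
    simp only [arcs, Finset.forall_mem_insert]
    exact ⟨congrArg (fun z => z.2.1) h, ih (congrArg Prod.fst h)⟩
  | dotLeft d ht hu hv ih => exact ih (congrArg Prod.fst h)
  | dotRight d ht hu hv ih => exact ih (congrArg Prod.fst h)

theorem dotHom_eq_of_degHom_eq {r s : ChineseMonoid n} (x : ℕ) (h : degHom n r = degHom n s) :
    dotHom n x r = dotHom n x s :=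
  map_eq_of_degHom_eq _ (fun _ _ => Commute.all _ _) h

theorem arcHom_eq_of_degHom_eq {r s : ChineseMonoid n} (x y : ℕ) (h : degHom n r = degHom n s)
    (hb : bHom n (x, y) r = bHom n (x, y) s) : arcHom n x y r = arcHom n x y s :=
  Prod.ext hb (map_eq_of_degHom_eq ((MonoidHom.snd _ _).comp (arcHom n x y))
    (fun _ _ => Commute.all _ _) h)

/-- All components other than those in `B` have commutative targets, so the multidegree determines
them. -/
theorem sHom_eq_of_degHom_eq {t : Step} {u v : ℕ} (d : Diagram n t u v) {r s : ChineseMonoid n}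
    (h : degHom n r = degHom n s) (hb : ∀ a ∈ arcs d, bHom n a r = bHom n a s) :
    sHom d r = sHom d s := by
  induction d with
  | dot x hs hsn => exact dotHom_eq_of_degHom_eq x h
  | arc x hx hxn => exact arcHom_eq_of_degHom_eq x (x + 1) h (hb _ (Finset.mem_singleton_self _))
  | arcAbove d hu hv ih =>
    simp only [arcs, Finset.forall_mem_insert] at hb
    exact Prod.ext (ih hb.2) (arcHom_eq_of_degHom_eq _ _ h hb.1)
  | dotLeft d ht hu hv ih => exact Prod.ext (ih hb) (dotHom_eq_of_degHom_eq _ h)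
  | dotRight d ht hu hv ih => exact Prod.ext (ih hb) (dotHom_eq_of_degHom_eq _ h)

theorem degHom_apply_eq_of_dotHom_eq {r s : ChineseMonoid n} (x : Idx n)
    (h : dotHom n x.1 r = dotHom n x.1 s) :
    (degHom n r).toAdd x = (degHom n s).toAdd x := by
  refine degHom_apply_eq_of_map_eq
    ((AddMonoidHom.toMultiplicative (Nat.castAddMonoidHom ℤ)).comp (dotHom n x.1)) x ?_
    (congrArg (AddMonoidHom.toMultiplicative (Nat.castAddMonoidHom ℤ)) h) fun l hl => Or.inl ?_
  · rw [MonoidHom.comp_apply, dotHom, liftHom_gen, if_pos rfl]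
    decide
  · rw [MonoidHom.comp_apply, dotHom, liftHom_gen, if_neg (fun h => hl (Subtype.ext h)), map_one]

/-- The difference of the numbers of factors `p` and `q`. -/
def Bicyclic.index : Bicyclic →* Multiplicative ℤ :=
  PresentedMonoid.lift (fun b => Multiplicative.ofAdd (if b then 1 else -1)) (by
    rintro _ _ ⟨⟩
    rfl)

/-- The `ℤ`-component counts `a_x`. The index of the `B`-component counts the letters up to `x`
minus those from `y` on; with the outer degrees and that of `a_x` known, only the degree of `a_y`
remains. Letters under the arc do not contribute. -/
theorem degHom_apply_eq_of_arcHom_eq {r s : ChineseMonoid n} {x y : Idx n} (hxy : x.1 < y.1)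
    (h : arcHom n x.1 y.1 r = arcHom n x.1 y.1 s)
    (hout : ∀ l : Idx n, l.1 < x.1 ∨ y.1 < l.1 → (degHom n r).toAdd l = (degHom n s).toAdd l) :
    (degHom n r).toAdd x = (degHom n s).toAdd x ∧
      (degHom n r).toAdd y = (degHom n s).toAdd y := by
  have hx : (degHom n r).toAdd x = (degHom n s).toAdd x := by
    refine degHom_apply_eq_of_map_eq ((MonoidHom.snd _ _).comp (arcHom n x.1 y.1)) x ?_
      (congrArg Prod.snd h) fun l hl => Or.inl ?_
    · change (if x.1 = x.1 then Multiplicative.ofAdd (1 : ℤ) else 1) ≠ 1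
      rw [if_pos rfl]
      decide
    · exact if_neg (fun h => hl (Subtype.ext h))
  refine ⟨hx, degHom_apply_eq_of_map_eq
    (Bicyclic.index.comp (bHom n (x.1, y.1))) y ?_ (congrArg (fun z => Bicyclic.index z.1) h)
    fun l hl => ?_⟩
  · rw [MonoidHom.comp_apply, bHom_gen_of_ge hxy le_rfl]
    change Multiplicative.ofAdd (-1 : ℤ) ≠ 1
    decide
  · by_cases h1 : x = l
    · exact Or.inr (h1 ▸ hx)
    · have h1' : x.1 ≠ l.1 := fun h => h1 (Subtype.ext h)
      have h2' : l.1 ≠ y.1 := fun h => hl (Subtype.ext h)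
      by_cases h2 : l.1 < x.1 ∨ y.1 < l.1
      · exact Or.inr (hout l h2)
      · refine Or.inl ?_
        rw [MonoidHom.comp_apply, bHom_gen_of_mem (by simp only; omega) (by simp only; omega),
          map_one]

theorem degHom_apply_eq_of_sHom_eq {t : Step} {u v : ℕ} (d : Diagram n t u v)
    {r s : ChineseMonoid n} (h : sHom d r = sHom d s)
    (hout : ∀ l : Idx n, l.1 < u ∨ v < l.1 → (degHom n r).toAdd l = (degHom n s).toAdd l)
    (l : Idx n) : (degHom n r).toAdd l = (degHom n s).toAdd l := by
  induction d with
  | dot x hs hsn =>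
    by_cases hl : l.1 = x
    · subst hl
      exact degHom_apply_eq_of_dotHom_eq l h
    · exact hout l (by omega)
  | arc x hx hxn =>
    have h1 := degHom_apply_eq_of_arcHom_eq (x := ⟨x, by omega⟩) (y := ⟨x + 1, by omega⟩)
      (by simp) h hout
    by_cases hl : l.1 = x
    · rw [show l = ⟨x, by omega⟩ from Subtype.ext hl]; exact h1.1
    · by_cases hl' : l.1 = x + 1
      · rw [show l = ⟨x + 1, by omega⟩ from Subtype.ext hl']; exact h1.2
      · exact hout l (by omega)
  | @arcAbove t u v d hu hv ih =>
    have := d.le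
    have h1 := degHom_apply_eq_of_arcHom_eq (x := ⟨u, by omega⟩) (y := ⟨v + 1, by omega⟩)
      (by simp only; omega) (congrArg Prod.snd h) hout
    -- The outermost arc has just yielded the degrees of its two ends, so the inner diagram has all
    -- its outside degrees known.
    refine ih (congrArg Prod.fst h) fun l hl' => ?_
    by_cases hl : l.1 = u
    · rw [show l = ⟨u, by omega⟩ from Subtype.ext hl]; exact h1.1
    · by_cases hl' : l.1 = v + 1
      · rw [show l = ⟨v + 1, by omega⟩ from Subtype.ext hl']; exact h1.2
      · exact hout l (by omega)
  | @dotLeft t u v d ht hu hv ih =>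
    refine ih (congrArg Prod.fst h) fun l hl' => ?_
    by_cases hl : l.1 = u
    · subst hl
      exact degHom_apply_eq_of_dotHom_eq l (congrArg Prod.snd h)
    · exact hout l (by omega)
  | @dotRight t u v d ht hu hv ih =>
    refine ih (congrArg Prod.fst h) fun l hl' => ?_
    by_cases hl : l.1 = v + 1
    · refine degHom_apply_eq_of_dotHom_eq l ?_
      rw [hl]
      exact congrArg Prod.snd h
    · exact hout l (by omega)

/-! ### The congruence of a leaf -/

theorem degHom_apply_eq_of_quotHom_eq {u v : ℕ} {ρ : Con (ChineseMonoid n)}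
    (hρ : CommuteOutside u v ρ) (hdeg : ρ ≤ Con.ker (degHom n)) {s t : ChineseMonoid n}
    (h : quotHom u v ρ hρ s = quotHom u v ρ hρ t) (l : Idx n) (hl : l.1 < u ∨ v < l.1) :
    (degHom n s).toAdd l = (degHom n t).toAdd l := by
  let c : Multiplicative (Idx n →₀ ℕ) →* Multiplicative ℕ :=
    AddMonoidHom.toMultiplicative (Finsupp.applyAddHom l)
  -- Only used generators are erased, so the degree in an unused one factors through `quotHom`.
  have key : (c.comp (ρ.lift (degHom n) hdeg)).comp (quotHom u v ρ hρ) = c.comp (degHom n) := by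
    refine hom_ext fun i => ?_
    by_cases hi : u ≤ i.1 ∧ i.1 ≤ v
    · have h1 : quotHom u v ρ hρ (gen i) = 1 := if_pos hi
      rw [MonoidHom.comp_apply, h1, map_one, MonoidHom.comp_apply, degHom_gen]
      have hne : i ≠ l := fun h => by subst h; omega
      change 1 = Multiplicative.ofAdd (Finsupp.single i 1 l)
      rw [Finsupp.single_eq_of_ne hne.symm]
      rfl
    · rw [MonoidHom.comp_apply, quotHom_gen hρ i hi]
      rfl
  have h2 := congrArg (c.comp (ρ.lift (degHom n) hdeg)) h
  rw [← MonoidHom.comp_apply, ← MonoidHom.comp_apply, key] at h2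
  exact h2

theorem degHom_eq_of_ker {t : Step} {u v : ℕ} (d : Diagram n t u v) {ρ : Con (ChineseMonoid n)}
    (hρ : CommuteOutside u v ρ) (hdeg : ρ ≤ Con.ker (degHom n)) :
    Con.ker ((quotHom u v ρ hρ).prod (sHom d)) ≤ Con.ker (degHom n) := by
  intro r s h
  rw [Con.ker_rel] at h ⊢
  refine Multiplicative.toAdd.injective (Finsupp.ext fun l => ?_)
  exact degHom_apply_eq_of_sHom_eq d (congrArg Prod.snd h)
    (fun l hl => degHom_apply_eq_of_quotHom_eq hρ hdeg (congrArg Prod.fst h) l hl) l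

theorem rhoAux_le_ker_degHom {t : Step} {u v : ℕ} (d : Diagram n t u v) :
    (rhoAux d).1 ≤ Con.ker (degHom n) := by
  induction d with
  | dot s hs hsn =>
    refine Con.conGen_le.2 fun r s h => ?_
    cases h <;> simp only [Con.ker_rel, map_mul] <;> ac_rfl
  | arc x hx hxn =>
    refine Con.conGen_le.2 fun r s h => ?_
    cases h <;> simp only [Con.ker_rel, map_mul] <;> ac_rfl
  | arcAbove d hu hv ih => exact degHom_eq_of_ker (.arcAbove d hu hv) _ ih
  | dotLeft d ht hu hv ih => exact degHom_eq_of_ker (.dotLeft d ht hu hv) _ ih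
  | dotRight d ht hu hv ih => exact degHom_eq_of_ker (.dotRight d ht hu hv) _ ih

/-! ### Congruences of `♢` type at the two ends, via normal forms. -/

theorem conGen_diamondRel_le_ker_bHom (x : ℕ) :
    conGen (DiamondRel n (x + 1)) ≤ Con.ker (bHom n (x, x + 1)) := by
  have hp : ∀ i : Idx n, i.1 + 1 ≤ x + 1 → bHom n (x, x + 1) (gen i) = Bicyclic.p :=
    fun i hi => bHom_gen_of_le (Nat.le_of_succ_le_succ hi)
  have hq : ∀ i : Idx n, x + 1 ≤ i.1 → bHom n (x, x + 1) (gen i) = Bicyclic.q :=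
    fun i hi => bHom_gen_of_ge (Nat.lt_succ_self x) hi
  refine Con.conGen_le.2 fun r s h => ?_
  cases h with
  | right m i hm hi => simp [Con.ker_rel, hq m hm, hq i hi]
  | rightTriple m i c hm hi hc => simp [Con.ker_rel, hq m hm, hq i hi]
  | left l m hl hm => simp only [Con.ker_rel, map_mul, hp l hl, hp m hm]
  | leftTriple l m c hl hm hc => simp only [Con.ker_rel, map_mul, hp l hl, hp m hm]

/-- Letters are prepended one by one. A letter `j ≠ c` meeting a nonempty left block of `c`'s takes
one `c` with it: the pair `f j * f c` passes through everything, and that `c` ends in the right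
block. Each `c` on the right is thus paid for by a letter different from `c`, which bounds `k`. -/
theorem exists_normalForm_left {α Q : Type*} [DecidableEq α] [Monoid Q] (f : α → Q) (c : α)
    (hf : ∀ j k, j ≠ c → k ≠ c → Commute (f j) (f k))
    (h1 : ∀ j, j ≠ c → Commute (f j * f c) (f c))
    (h2 : ∀ j k, j ≠ c → k ≠ c → Commute (f j * f c) (f k)) (w : List α) :
    ∃ i k : ℕ, i + k = w.count c ∧ k ≤ (w.filter (· ≠ c)).length ∧
      (w.map f).prod = f c ^ i * ((w.filter (· ≠ c)).map f).prod * f c ^ k := by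
  induction w with
  | nil => exact ⟨0, 0, by simp⟩
  | cons j w ih =>
    obtain ⟨i, k, hik, hk, hw⟩ := ih
    by_cases hj : j = c
    · subst hj
      refine ⟨i + 1, k, by simp; omega, by simpa using hk, ?_⟩
      rw [List.map_cons, List.prod_cons, hw, List.filter_cons_of_neg (by simp)]
      simp only [pow_succ', mul_assoc]
    · rw [List.filter_cons_of_pos (by simpa using hj), List.map_cons, List.map_cons,
        List.prod_cons, List.prod_cons, hw, List.count_cons_of_ne (by simpa using hj),
        List.length_cons]
      set m := ((w.filter (· ≠ c)).map f).prod with hm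
      have hcomm : ∀ z, (∀ l, l ≠ c → Commute z (f l)) → Commute z m := fun z hz => by
        refine Commute.list_prod_right _ _ fun y hy => ?_
        obtain ⟨l, hl, rfl⟩ := List.mem_map.1 hy
        exact hz l (by simpa using (List.mem_filter.1 hl).2)
      rcases i with _ | i
      · exact ⟨0, k, hik, by omega, by simp [mul_assoc]⟩
      · refine ⟨i, k + 1, by omega, by omega, ?_⟩
        have e1 : Commute (f j * f c) (f c ^ i) := (h1 j hj).pow_right i
        have e2 : Commute (f j * f c) m := hcomm _ fun l hl => h2 j l hj hl
        have e3 : Commute (f j) m := hcomm _ fun l hl => hf j l hj hl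
        calc f j * (f c ^ (i + 1) * m * f c ^ k)
            = f j * f c * f c ^ i * m * f c ^ k := by simp only [pow_succ', mul_assoc]
          _ = f c ^ i * (f j * f c * m) * f c ^ k := by rw [e1.eq]; simp only [mul_assoc]
          _ = f c ^ i * (m * f j) * (f c * f c ^ k) := by rw [e2.eq]; simp only [mul_assoc]
          _ = f c ^ i * (f j * m) * f c ^ (k + 1) := by rw [e3.eq, pow_succ']

/-- The mirror image, obtained in the opposite monoid for the reversed word. -/
theorem exists_normalForm_right {α Q : Type*} [DecidableEq α] [Monoid Q] (f : α → Q) (c : α)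
    (hf : ∀ j k, j ≠ c → k ≠ c → Commute (f j) (f k))
    (h1 : ∀ j, j ≠ c → Commute (f c * f j) (f c))
    (h2 : ∀ j k, j ≠ c → k ≠ c → Commute (f c * f j) (f k)) (w : List α) :
    ∃ i k : ℕ, i + k = w.count c ∧ k ≤ (w.filter (· ≠ c)).length ∧
      (w.map f).prod = f c ^ k * ((w.filter (· ≠ c)).map f).prod * f c ^ i := by
  obtain ⟨i, k, hik, hk, hw⟩ := exists_normalForm_left (fun j => MulOpposite.op (f j)) c
    (fun j k hj hk => (hf j k hj hk).op) (fun j hj => (h1 j hj).op)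
    (fun j k hj hk => (h2 j k hj hk).op) w.reverse
  refine ⟨i, k, by simpa using hik, by simpa [List.filter_reverse] using hk, ?_⟩
  have h := congrArg MulOpposite.unop hw
  simp only [MulOpposite.unop_mul, MulOpposite.unop_pow, MulOpposite.unop_op,
    MulOpposite.unop_list_prod, List.filter_reverse, List.map_reverse, List.reverse_reverse,
    List.map_map, Function.comp_def] at h
  rw [h, mul_assoc]

theorem Bicyclic.toPair_p_pow_mul_q_pow_mul_p_pow {i j k : ℕ} (h : k ≤ j) :
    Bicyclic.toPair (Bicyclic.p ^ i * Bicyclic.q ^ j * Bicyclic.p ^ k) = ⟨i, j - k⟩ := by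
  simp only [map_mul, map_pow, Bicyclic.toPair_p, Bicyclic.toPair_q, BicyclicPair.p_pow,
    BicyclicPair.q_pow]
  ext <;> simp [BicyclicPair.up_mul, BicyclicPair.down_mul]; omega

theorem Bicyclic.toPair_q_pow_mul_p_pow_mul_q_pow {i j k : ℕ} (h : k ≤ j) :
    Bicyclic.toPair (Bicyclic.q ^ k * Bicyclic.p ^ j * Bicyclic.q ^ i) = ⟨j - k, i⟩ := by
  simp only [map_mul, map_pow, Bicyclic.toPair_p, Bicyclic.toPair_q, BicyclicPair.p_pow,
    BicyclicPair.q_pow]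
  ext <;> simp [BicyclicPair.up_mul, BicyclicPair.down_mul]; omega

theorem gen_mul_gen_mul_gen {i k j : Idx n} (hik : i ≤ k) (hkj : k ≤ j) :
    gen j * gen i * gen k = gen j * gen k * gen i ∧
      gen j * gen k * gen i = gen k * gen j * gen i :=
  ⟨PresentedMonoid.mk_eq_mk_of_rel (ChineseRel.first i k j hik hkj),
    PresentedMonoid.mk_eq_mk_of_rel (ChineseRel.second i k j hik hkj)⟩

theorem prod_map_snd_eq_pow {α A B : Type*} [Monoid A] [Monoid B] (f : α → A × B) (b : B)
    (w : List α) (h : ∀ i ∈ w, (f i).2 = b) : (w.map f).prod.2 = b ^ w.length := by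
  induction w with
  | nil => simp
  | cons i w ih =>
    rw [List.map_cons, List.prod_cons, Prod.snd_mul, ih fun j hj => h j (by simp [hj]),
      h i (by simp), List.length_cons, pow_succ']

theorem prod_map_filter_eq_of_perm {α A : Type*} [DecidableEq α] [Monoid A] (f : α → A) {c : α}
    (hf : ∀ j k, j ≠ c → k ≠ c → Commute (f j) (f k)) {w w' : List α} (h : w.Perm w') :
    ((w.filter (· ≠ c)).map f).prod = ((w'.filter (· ≠ c)).map f).prod := by
  refine ((h.filter _).map _).prod_eq' (List.pairwise_map.2 ?_)
  refine List.Pairwise.imp_of_mem (R := fun _ _ => True) (fun {a b} ha hb _ => hf a b ?_ ?_)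
    (List.pairwise_of_forall fun _ _ => trivial)
  · simpa using (List.mem_filter.1 ha).2
  · simpa using (List.mem_filter.1 hb).2

/-- The normal form with `c = a_1` has exponents `i`, `k` determined by the multidegree and the
bicyclic image, so equal data give the same normal form modulo `ρ`. -/
theorem rel_of_degHom_eq_of_bHom_eq_left {ρ : Con (ChineseMonoid n)}
    (hρ : conGen (DiamondRel n 2) ≤ ρ) (hn : 2 ≤ n)
    {s t : ChineseMonoid n} (hd : degHom n s = degHom n t)
    (hb : bHom n (1, 2) s = bHom n (1, 2) t) : ρ s t := by
  obtain ⟨w, rfl⟩ := exists_prod_map_gen_eq s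
  obtain ⟨w', rfl⟩ := exists_prod_map_gen_eq t
  have hperm := perm_of_degHom_eq hd
  let c : Idx n := ⟨1, by omega⟩
  have hge : ∀ j : Idx n, j ≠ c → 2 ≤ j.1 := fun j hj => by
    have h1 := j.2.1
    have h2 : j.1 ≠ 1 := fun h => hj (Subtype.ext h)
    omega
  -- Working in the product gives one pair of exponents valid in both the quotient and `B`.
  let F : ChineseMonoid n →* ρ.Quotient × Bicyclic := ρ.mk'.prod (bHom n (1, 2))
  have hFc : (F (gen c)).2 = Bicyclic.p := bHom_gen_of_le le_rfl
  have hFj : ∀ j, j ≠ c → (F (gen j)).2 = Bicyclic.q := fun j hj =>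
    bHom_gen_of_ge (by simp) (hge j hj)
  have hrel : ∀ {a b}, DiamondRel n 2 a b → ρ a b := fun h => hρ (ConGen.Rel.of _ _ h)
  have hF : ∀ {a b}, ρ a b → bHom n (1, 2) a = bHom n (1, 2) b → F a = F b := fun h h' =>
    Prod.ext ((Con.eq ρ).2 h) h'
  have hf : ∀ j k, j ≠ c → k ≠ c → Commute (F (gen j)) (F (gen k)) := fun j k hj hk => by
    rw [Commute, SemiconjBy, ← map_mul, ← map_mul]
    refine hF (hrel (.right j k (hge j hj) (hge k hk))) ?_
    exact conGen_diamondRel_le_ker_bHom 1 (ConGen.Rel.of _ _ (.right j k (hge j hj) (hge k hk)))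
  have h1 : ∀ j, j ≠ c → Commute (F (gen j) * F (gen c)) (F (gen c)) := fun j hj => by
    rw [Commute, SemiconjBy, ← map_mul, ← map_mul, ← map_mul, ← mul_assoc]
    exact congrArg F (gen_mul_gen_mul_gen le_rfl j.2.1).2
  have h2 : ∀ j k, j ≠ c → k ≠ c → Commute (F (gen j) * F (gen c)) (F (gen k)) :=
    fun j k hj hk => by
      rw [Commute, SemiconjBy, ← map_mul, ← map_mul, ← map_mul, ← mul_assoc]
      rcases le_total k j with hkj | hjk
      · have h := gen_mul_gen_mul_gen (show c ≤ k from k.2.1) hkj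
        rw [h.1, h.2]
      · have h := gen_mul_gen_mul_gen (show c ≤ j from j.2.1) hjk
        rw [← h.1]
        have h3 := DiamondRel.rightTriple (n := n) k j c (hge k hk) (hge j hj) rfl
        exact hF (hrel h3) (conGen_diamondRel_le_ker_bHom 1 (ConGen.Rel.of _ _ h3))
  obtain ⟨i, k, hik, hk, hw⟩ := exists_normalForm_left (fun i => F (gen i)) c hf h1 h2 w
  obtain ⟨i', k', hik', hk', hw'⟩ := exists_normalForm_left (fun i => F (gen i)) c hf h1 h2 w'
  have hfilter := prod_map_filter_eq_of_perm _ hf hperm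
  have hsnd : ∀ w : List (Idx n), ((w.filter (· ≠ c)).map fun i => F (gen i)).prod.2 =
      Bicyclic.q ^ (w.filter (· ≠ c)).length := fun w =>
    prod_map_snd_eq_pow _ _ _ fun j hj => hFj j (by simpa using (List.mem_filter.1 hj).2)
  rw [← map_prod_map_gen] at hw hw'
  have e1 := congrArg (fun z => (Bicyclic.toPair z.2).up) hw
  have e2 := congrArg (fun z => (Bicyclic.toPair z.2).up) hw'
  simp only [Prod.snd_mul, Prod.pow_snd, hsnd, hFc] at e1 e2
  -- Because `k` is at most the number of `q`'s, the last block of `p`'s cancels completely, and `i`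
  -- is the exponent of `p` in the bicyclic normal form. The total number of `c`'s then gives `k`.
  rw [Bicyclic.toPair_p_pow_mul_q_pow_mul_p_pow hk] at e1
  rw [Bicyclic.toPair_p_pow_mul_q_pow_mul_p_pow hk'] at e2
  have e3 : i = i' := e1.symm.trans ((congrArg (fun z => (Bicyclic.toPair z).up) hb).trans e2)
  have e4 : i + k = i' + k' := by
    rw [hik, hik']
    exact hperm.countP_eq _
  have e5 : k = k' := by omega
  rw [← e3, ← e5, ← hfilter, ← hw] at hw'
  exact (Con.eq ρ).1 (congrArg Prod.fst hw'.symm)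

theorem rel_of_degHom_eq_of_bHom_eq_right {x : ℕ} {ρ : Con (ChineseMonoid n)}
    (hρ : conGen (DiamondRel n (x + 1)) ≤ ρ) (hx : 1 ≤ x) (hn : x + 1 = n)
    {s t : ChineseMonoid n} (hd : degHom n s = degHom n t)
    (hb : bHom n (x, x + 1) s = bHom n (x, x + 1) t) : ρ s t := by
  obtain ⟨w, rfl⟩ := exists_prod_map_gen_eq s
  obtain ⟨w', rfl⟩ := exists_prod_map_gen_eq t
  have hperm := perm_of_degHom_eq hd
  let c : Idx n := ⟨x + 1, by omega⟩
  have hle : ∀ j : Idx n, j ≠ c → j.1 + 1 ≤ x + 1 := fun j hj => by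
    have h1 := j.2.2
    have h2 : j.1 ≠ x + 1 := fun h => hj (Subtype.ext h)
    omega
  let F : ChineseMonoid n →* ρ.Quotient × Bicyclic := ρ.mk'.prod (bHom n (x, x + 1))
  have hFc : (F (gen c)).2 = Bicyclic.q := bHom_gen_of_ge (Nat.lt_succ_self x) le_rfl
  have hFj : ∀ j, j ≠ c → (F (gen j)).2 = Bicyclic.p := fun j hj =>
    bHom_gen_of_le (Nat.le_of_succ_le_succ (hle j hj))
  have hrel : ∀ {a b}, DiamondRel n (x + 1) a b → ρ a b := fun h => hρ (ConGen.Rel.of _ _ h)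
  have hF : ∀ {a b}, ρ a b → bHom n (x, x + 1) a = bHom n (x, x + 1) b → F a = F b := fun h h' =>
    Prod.ext ((Con.eq ρ).2 h) h'
  have hf : ∀ j k, j ≠ c → k ≠ c → Commute (F (gen j)) (F (gen k)) := fun j k hj hk => by
    rw [Commute, SemiconjBy, ← map_mul, ← map_mul]
    refine hF (hrel (.left j k (hle j hj) (hle k hk))) ?_
    exact conGen_diamondRel_le_ker_bHom x (ConGen.Rel.of _ _ (.left j k (hle j hj) (hle k hk)))
  have hjc : ∀ j : Idx n, j ≤ c := fun j => j.2.2.trans hn.ge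
  have h1 : ∀ j, j ≠ c → Commute (F (gen c) * F (gen j)) (F (gen c)) := fun j _ => by
    rw [Commute, SemiconjBy, ← map_mul, ← map_mul, ← map_mul, ← mul_assoc]
    exact congrArg F (gen_mul_gen_mul_gen (hjc j) le_rfl).1
  have h2 : ∀ j k, j ≠ c → k ≠ c → Commute (F (gen c) * F (gen j)) (F (gen k)) :=
    fun j k hj hk => by
      rw [Commute, SemiconjBy, ← map_mul, ← map_mul, ← map_mul, ← mul_assoc]
      rcases le_total j k with hjk | hkj
      · have h := gen_mul_gen_mul_gen hjk (hjc k)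
        rw [h.1, h.2]
      · have h := gen_mul_gen_mul_gen hkj (hjc j)
        rw [h.2]
        have h3 := DiamondRel.leftTriple (n := n) j k c (hle j hj) (hle k hk) rfl
        exact hF (hrel h3) (conGen_diamondRel_le_ker_bHom x (ConGen.Rel.of _ _ h3))
  obtain ⟨i, k, hik, hk, hw⟩ := exists_normalForm_right (fun i => F (gen i)) c hf h1 h2 w
  obtain ⟨i', k', hik', hk', hw'⟩ := exists_normalForm_right (fun i => F (gen i)) c hf h1 h2 w'
  have hfilter := prod_map_filter_eq_of_perm _ hf hperm
  have hsnd : ∀ w : List (Idx n), ((w.filter (· ≠ c)).map fun i => F (gen i)).prod.2 =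
      Bicyclic.p ^ (w.filter (· ≠ c)).length := fun w =>
    prod_map_snd_eq_pow _ _ _ fun j hj => hFj j (by simpa using (List.mem_filter.1 hj).2)
  rw [← map_prod_map_gen] at hw hw'
  have e1 := congrArg (fun z => (Bicyclic.toPair z.2).down) hw
  have e2 := congrArg (fun z => (Bicyclic.toPair z.2).down) hw'
  simp only [Prod.snd_mul, Prod.pow_snd, hsnd, hFc] at e1 e2
  rw [Bicyclic.toPair_q_pow_mul_p_pow_mul_q_pow hk] at e1
  rw [Bicyclic.toPair_q_pow_mul_p_pow_mul_q_pow hk'] at e2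
  have e3 : i = i' := e1.symm.trans ((congrArg (fun z => (Bicyclic.toPair z).down) hb).trans e2)
  have e4 : i + k = i' + k' := by
    rw [hik, hik']
    exact hperm.countP_eq _
  have e5 : k = k' := by omega
  rw [← e3, ← e5, ← hfilter, ← hw] at hw'
  exact (Con.eq ρ).1 (congrArg Prod.fst hw'.symm)

/-- The congruence of a leaf is given by the multidegree and the arc components. -/
theorem rhoAux_iff_of_isLeaf {t : Step} {u v : ℕ} (d : Diagram n t u v) (ht : t = .arc)
    (huv : u = 1 ∨ v = n) (r s : ChineseMonoid n) :
    (rhoAux d).1 r s ↔ degHom n r = degHom n s ∧ ∀ a ∈ arcs d, bHom n a r = bHom n a s := by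
  refine ⟨fun h => ⟨rhoAux_le_ker_degHom d h, ?_⟩, fun ⟨hd, hb⟩ => ?_⟩
  · cases d with
    | arc x hx hxn =>
      simp only [arcs, Finset.mem_singleton, forall_eq]
      exact conGen_diamondRel_le_ker_bHom _ h
    | arcAbove d hu hv => exact bHom_eq_of_sHom_eq (.arcAbove d hu hv) (congrArg Prod.snd h)
    | _ => cases ht
  · cases d with
    | arc x hx hxn =>
      simp only [arcs, Finset.mem_singleton, forall_eq] at hb
      rcases huv with rfl | rfl
      · exact rel_of_degHom_eq_of_bHom_eq_left le_rfl hxn hd hb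
      · exact rel_of_degHom_eq_of_bHom_eq_right le_rfl hx rfl hd hb
    | @arcAbove t u v d hu hv =>
      -- The new arc reaches an end, so two unused generators are on the same side and commute
      -- modulo the previous congruence; used ones become `1`. Hence the quotient component depends
      -- only on the multidegree.
      refine Prod.ext (map_eq_of_degHom_eq (quotHom u (v + 1) (rhoAux d).1 _) (fun i j => ?_) hd)
        (sHom_eq_of_degHom_eq (.arcAbove d hu hv) hd hb)
      by_cases hi : u ≤ i.1 ∧ i.1 ≤ v + 1
      · rw [show quotHom u (v + 1) (rhoAux d).1 _ (gen i) = 1 from if_pos hi]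
        exact Commute.one_left _
      by_cases hj : u ≤ j.1 ∧ j.1 ≤ v + 1
      · rw [show quotHom u (v + 1) (rhoAux d).1 _ (gen j) = 1 from if_pos hj]
        exact Commute.one_right _
      rw [quotHom_gen _ i hi, quotHom_gen _ j hj, Commute, SemiconjBy, ← Con.coe_mul,
        ← Con.coe_mul]
      refine (Con.eq _).2 ((rhoAux d).2 i j ?_)
      have := d.le
      have := i.2
      have := j.2
      omega
    | _ => cases ht

end ChineseAlgebra

theorem theorem2p2p12 (K : Type*) [Field K] (n : ℕ) (hn : 3 ≤ n)
    (d : ChineseAlgebra.Vertex n) (hd : d.IsLeaf) :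
    ChineseAlgebra.IsPrimeIdeal (ChineseAlgebra.congIdeal K (ChineseAlgebra.rho d)) := by
  open ChineseAlgebra in
  cases d with
  | root => exact hd.elim
  | node d =>
    refine isPrimeIdeal_congIdeal (ι := {a // a ∈ arcs d}) _ (degHom n)
      (fun a => Bicyclic.toPair.comp (bHom n a.1)) (fun r s => ?_) fun a => ?_
    · refine (rhoAux_iff_of_isLeaf d hd.1 hd.2 r s).trans (and_congr_right fun _ => ?_)
      simp [Bicyclic.toPair_injective.eq_iff]
    · obtain ⟨P, Q, h1, h2, h3, -⟩ := (exists_bHom_eq d).2 a.1 a.2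
      refine ⟨P, Q, by simp [h1], by simp [h2], fun b hb => ?_⟩
      have h4 := h3 b.1 b.2 fun h => hb (Subtype.ext h)
      simp [h4.1, h4.2]
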